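/- Let $d\in(-\tfrac12,\tfrac12)\setminus\{0\}$ and $\mathbb R_+=[0,\infty)$. Let $\mathrm{Li}_{-2d-1}$ be the polylogarithm on $\mathbb C\setminus[1,\infty)$, $$\mathrm{Li}_{-2d-1}(z)=\frac1{\Gamma(1-2d)}\int_1^\infty(\log\tau)^{-2d}\,\frac{z(\tau+z)}{(\tau-z)^3}\,d\tau ,$$ and define $$Q(z)=\frac1{4\pi}\,(z^{-1}-2+z)\big(\mathrm{Li}_{-2d-1}(z)+\mathrm{Li}_{-2d-1}(z^{-1})\big),\qquad z\in\mathbb C\setminus\mathbb R_+ .$$ For $t>0$ let $Q^{+}(t)$ and $Q^-(t)$ be the limits of $Q(z)$ as $z\to t$ from the upper and the lower open half-plane. Let $$f_0(\lambda)=\frac{\Gamma(2d+2)\cos(\pi d)}{2\pi}\,|1-e^{i\lambda}|^2\sum_{k=-\infty}^{\infty}|\lambda+2\pi k|^{-2d-2}$$ be the spectral density of the fractional Gaussian noise. All powers and logarithms are principal branches. Then $\mathrm{Li}_{-2d-1}$ is holomorphic on $\mathbb C\setminus[1,\infty)$ and equals $\sum_{k\ge1}k^{2d+1}z^k$ for $|z|<1$.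 Moreover, $Q$ is sectionally holomorphic off $\mathbb R_+$: it is holomorphic in $\mathbb C\setminus\mathbb R_+$, and the finite limits $Q^\pm(t)$ exist for all $t>0$, except possibly at $t=1$ when $d>0$. Furthermore: (i) $Q(z)=Q(z^{-1})$ and $\overline{Q(z)}=Q(\overline z)$ for $z\in\mathbb C\setminus\mathbb R_+$. For all $t>0$ (with $t\neq1$ if $d>0$), $Q^\pm(t)=Q^\mp(t^{-1})$ and $\overline{Q^\pm(t)}=Q^\mp(t)$. The sign of $\operatorname{Im}Q^+(t)$ is $-\operatorname{sign}(d)$ for $t\in(0,1)$ and $\operatorname{sign}(d)$ for $t\in(1,\infty)$. (ii) $Q(e^{i\lambda})=f_0(\lambda)$ for $\lambda\in(-\pi,\pi]\setminus\{0\}$. (iii) For $z\in\mathbb C\setminus\mathbb R_+$, $$Q(z)=\begin{cases}O\big(z^{-1}(\log z^{-1})^{-1-2d}\big),&z\to0,\\ O\big((z-1)^{-2d}\big),&z\to1,\\ O\big(z(\log z)^{-1-2d}\big),&z\to\infty.\end{cases}$$ (iv) If $d>0$, then $Q$ has at least one zero in $(-1,0)$. (v) The function $\eta(t)=\arg Q^+(t)\in(-\pi,\pi]$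 has derivatives of all orders on $(0,1)\cup(1,\infty)$ and satisfies $\eta(t)=-\eta(t^{-1})$ for all $t>0$, $t\ne1$. As $t\nearrow1$, $$\eta(t)=-d\pi+O\big((1-t)^{2+2d}\big),$$ and there is a constant $c\in\mathbb R$, possibly depending on $d$, such that, as $t\searrow0$, $$\eta(t)=\pi\mathbf 1_{\{d<0\}}+\frac{c}{\log t^{-1}}+O\big((\log t^{-1})^{-2}\big).$$ -/

import Mathlib

open Filter Topology Asymptotics
open scoped ContDiff ComplexConjugate

noncomputable section

namespace FGN

/-- The polylogarithm `Li_s` of real order `s > -2`, as a holomorphic function on the plane cut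
along `[1, ∞)`, by its integral representation
`Li_s(z) = (1 / Γ(s+2)) ∫_1^∞ (log τ)^(s+1) z (τ + z) / (τ - z)^3 dτ`.
The integral converges absolutely for all `z` outside `[1, ∞)`.
The theorem asserts, as part of its conclusion, that for the order in question this function is
holomorphic there and is the sum of `∑_{k ≥ 1} z^k / k^s` in the unit disk, which determines it. -/
def polylog (s : ℝ) (z : ℂ) : ℂ :=
  ((1 / Real.Gamma (s + 2) : ℝ) : ℂ) *
    ∫ τ in Set.Ioi (1 : ℝ),
      ((Real.log τ ^ (s + 1) : ℝ) : ℂ) * (z * ((τ : ℂ) + z) / ((τ : ℂ) - z) ^ 3)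

/-- The function `Q(z) = (1/4π) (z⁻¹ - 2 + z) (Li_{-2d-1}(z) + Li_{-2d-1}(z⁻¹))`. -/
def Q (d : ℝ) (z : ℂ) : ℂ :=
  (1 / (4 * (Real.pi : ℂ))) * (z⁻¹ - 2 + z) *
    (polylog (-2 * d - 1) z + polylog (-2 * d - 1) z⁻¹)

/-- The complex plane cut along the real set `L`. -/
def cutPlane (L : Set ℝ) : Set ℂ := (Complex.ofReal '' L)ᶜ

/-- Points approaching the real point `t` from the upper half-plane. -/
def nhdsAbove (t : ℝ) : Filter ℂ := 𝓝[{z : ℂ | 0 < z.im}] (t : ℂ)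

/-- Points approaching the real point `t` from the lower half-plane. -/
def nhdsBelow (t : ℝ) : Filter ℂ := 𝓝[{z : ℂ | z.im < 0}] (t : ℂ)

/-- `F` is sectionally holomorphic off the real set `L`, up to singularities at the points of `S`:
it is holomorphic outside `L` and has finite one-sided limits, from the upper and from the lower
half-plane, at all points of `L` that are not in `S`. -/
def SectionallyHolomorphic (F : ℂ → ℂ) (L S : Set ℝ) : Prop :=
  DifferentiableOn ℂ F (cutPlane L) ∧
    ∀ t ∈ L, t ∉ S →
      (∃ a : ℂ, Tendsto F (nhdsAbove t) (𝓝 a)) ∧ (∃ b : ℂ, Tendsto F (nhdsBelow t) (𝓝 b))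

/-- `Q⁺(t)`, the limit of `Q` at `t` from the upper half-plane. -/
def Qplus (d : ℝ) (t : ℝ) : ℂ := limUnder (nhdsAbove t) (Q d)

/-- `Q⁻(t)`, the limit of `Q` at `t` from the lower half-plane. -/
def Qminus (d : ℝ) (t : ℝ) : ℂ := limUnder (nhdsBelow t) (Q d)

/-- The spectral density of the fractional Gaussian noise,
`f₀(x) = c(d) |1 - e^{ix}|² ∑_{k ∈ ℤ} |x + 2πk|^{-2d-2}`, `c(d) = (1/2π) Γ(2d+2) cos(πd)`. -/
def fGnDensity (d : ℝ) (x : ℝ) : ℝ :=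
  (1 / (2 * Real.pi) * Real.Gamma (2 * d + 2) * Real.cos (Real.pi * d)) *
    ‖1 - Complex.exp (Complex.I * (x : ℂ))‖ ^ 2 *
    ∑' k : ℤ, |x + 2 * Real.pi * (k : ℝ)| ^ (-2 * d - 2)

/-- `η(t) = arg Q⁺(t)`, with values in `(-π, π]`. -/
def eta (d : ℝ) (t : ℝ) : ℝ := Complex.arg (Qplus d t)

end FGN

end

/-! ### The integral of `u^a / (u+b)^3` over the half-line -/

namespace FGN

open MeasureTheory Set

/-! Everything rests on one explicit formula for `Q` in the coordinate `l` with `z = e^{il}`, `0 <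
Re l < 2π`. Put `p = -2d-2` and `K(ζ) = ∑_{k≥0} (ζ+2πk)^p` (`latticeSum`). Then `Q(e^{il}) = -c(d)
(z⁻¹ - 2 + z) (K(l) + K(2π - l))` (`Q_exp_I_mul`).

To derive it, substitute `τ = e^u` in the polylogarithm. With `z = e^w`, the kernel depends only on
`v = u - w` and has the partial fractions `∑_k 2/(v+2πik)^3`. Integrating against `u^{s+1}` term by
term gives `Li_s(e^w) = Γ(1-s) ∑_k (-w+2πik)^{s-1}` (`hasSum_polylog_exp`). Splitting the sum by the
sign of `k` is Jonquière's formula, and adding the formulas for `z` and `z⁻¹` merges the phases into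
a cosine.

For real `l` the formula is the spectral density. Near the upper edge of the cut only the term `l^p`
of `K(l)` is singular at `l = 0`; the rest continues across the edge, which gives the boundary
values and the growth at `1`. At `l = iy`, with `y = -log t > 0`, the remaining sums are complex
conjugates, so up to a positive factor `Q⁺(t)` is `e^{-iπd} - 2 y^{2d+2} Re K(2π+iy)`, whose
imaginary part `-sin πd` does not depend on `t`. This yields the sign, the smoothness of `η`, and
its behaviour as `y → 0`.

For large `ζ` in the closed right half-plane, comparison with an integral gives `K(ζ) =
-ζ^{p+1}/(2π(p+1)) + O(|ζ|^p)` (`exists_norm_latticeSum_sub_le`). It yields the expansion of `η` at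
`0` and, on the line `Re l = π`, which parametrizes the negative axis, a change of sign of `Re K`
when `d > 0`, hence a zero. -/

theorem integrableOn_rpow_div_add_pow_three {a b : ℝ} (ha : -1 < a) (ha2 : a < 2) (hb : 0 < b) :
    IntegrableOn (fun u : ℝ => u ^ a / (u + b) ^ 3) (Ioi 0) := by
  rw [← Ioc_union_Ioi_eq_Ioi zero_le_one]
  refine IntegrableOn.union ?_ ?_
  · have h : IntegrableOn (fun u : ℝ => u ^ a * (b ^ 3)⁻¹) (Ioc 0 1) :=
      ((intervalIntegrable_iff_integrableOn_Ioc_of_le zero_le_one).1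
        (intervalIntegral.intervalIntegrable_rpow' ha)).mul_const _
    refine Integrable.mono' h (Measurable.aestronglyMeasurable (by fun_prop)) ?_
    refine (ae_restrict_iff' measurableSet_Ioc).2 (Eventually.of_forall fun u hu => ?_)
    have hu0 : 0 < u := hu.1
    rw [Real.norm_of_nonneg (by positivity), div_eq_mul_inv]
    gcongr
    linarith
  · have h : IntegrableOn (fun u : ℝ => u ^ (a - 3)) (Ioi 1) :=
      integrableOn_Ioi_rpow_of_lt (by linarith) one_pos
    refine Integrable.mono' h (Measurable.aestronglyMeasurable (by fun_prop)) ?_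
    refine (ae_restrict_iff' measurableSet_Ioi).2 (Eventually.of_forall fun u hu => ?_)
    have hu0 : 0 < u := lt_trans one_pos hu
    rw [Real.norm_of_nonneg (by positivity), Real.rpow_sub hu0]
    norm_cast
    gcongr
    linarith

/-- Write `2/(u+b)^3` as `∫ t^2 e^{-(u+b)t} dt` and exchange the integrals; both remaining integrals
are Gamma integrals. -/
theorem integral_rpow_div_add_pow_three {a b : ℝ} (ha : -1 < a) (ha2 : a < 2) (hb : 0 < b) :
    ∫ u in Ioi (0 : ℝ), u ^ a / (u + b) ^ 3 =
      Real.Gamma (1 + a) * Real.Gamma (2 - a) / 2 * b ^ (a - 2) := by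
  have h3 : ∀ c : ℝ, 0 < c → ∫ t in Ioi (0 : ℝ), t ^ 2 * Real.exp (-(c * t)) = 2 / c ^ 3 := by
    intro c hc
    have := Real.integral_rpow_mul_exp_neg_mul_Ioi (a := 3) (r := c) (by norm_num) hc
    have hG : Real.Gamma 3 = 2 := by simp [Nat.factorial]
    rw [hG] at this
    norm_num at this
    rw [this]
    field_simp
  have h3i : ∀ c : ℝ, 0 < c → IntegrableOn (fun t : ℝ => t ^ 2 * Real.exp (-(c * t))) (Ioi 0) := by
    intro c hc
    -- A non-integrable function has integral `0` by convention, so a nonzero value of the integral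
    -- already proves integrability.
    by_contra hn
    have h0 := h3 c hc
    rw [integral_undef hn] at h0
    have : 0 < 2 / c ^ 3 := by positivity
    linarith
  set f : ℝ → ℝ → ℝ := fun u t => u ^ a * (t ^ 2 * Real.exp (-((u + b) * t))) with hf
  have hfu : ∀ u ∈ Ioi (0 : ℝ), ∫ t in Ioi (0 : ℝ), f u t = 2 * (u ^ a / (u + b) ^ 3) := by
    intro u hu
    simp only [hf]
    rw [integral_const_mul, h3 (u + b) (add_pos hu hb)]
    ring
  have hint : Integrable (Function.uncurry f)
      ((volume.restrict (Ioi 0)).prod (volume.restrict (Ioi 0))) := by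
    rw [integrable_prod_iff]
    · constructor
      · refine (ae_restrict_iff' measurableSet_Ioi).2 (Eventually.of_forall fun u hu => ?_)
        exact (h3i (u + b) (add_pos hu hb)).const_mul (u ^ a)
      · have := (integrableOn_rpow_div_add_pow_three ha ha2 hb).const_mul 2
        refine this.congr ?_
        refine (ae_restrict_iff' measurableSet_Ioi).2 (Eventually.of_forall fun u hu => ?_)
        simp only [Function.uncurry]
        rw [← hfu u hu]
        refine setIntegral_congr_fun measurableSet_Ioi fun t ht => ?_
        have hu0 : 0 < u := hu
        simp only [hf]
        rw [Real.norm_of_nonneg (by positivity)]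
    · apply Measurable.aestronglyMeasurable
      simp only [hf, Function.uncurry_def]
      fun_prop
  have hsw := integral_integral_swap hint
  have hL : ∫ u in Ioi (0 : ℝ), ∫ t in Ioi (0 : ℝ), f u t =
      2 * ∫ u in Ioi (0 : ℝ), u ^ a / (u + b) ^ 3 := by
    rw [← integral_const_mul]
    exact setIntegral_congr_fun measurableSet_Ioi hfu
  have hR : ∫ t in Ioi (0 : ℝ), ∫ u in Ioi (0 : ℝ), f u t =
      Real.Gamma (1 + a) * (Real.Gamma (2 - a) * b ^ (a - 2)) := by
    have : ∀ t ∈ Ioi (0 : ℝ), ∫ u in Ioi (0 : ℝ), f u t =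
        Real.Gamma (1 + a) * (t ^ ((2 - a) - 1) * Real.exp (-(b * t))) := by
      intro t ht
      have ht0 : 0 < t := ht
      have h := Real.integral_rpow_mul_exp_neg_mul_Ioi (a := 1 + a) (r := t) (by linarith) ht
      have hft : ∀ u, f u t = (t ^ 2 * Real.exp (-(b * t))) *
          (u ^ (1 + a - 1) * Real.exp (-(t * u))) := by
        intro u
        simp only [hf]
        rw [add_sub_cancel_left, show -((u + b) * t) = -(b * t) + -(t * u) by ring, Real.exp_add]
        ring
      simp_rw [hft]
      rw [integral_const_mul, h, one_div, Real.inv_rpow ht0.le, ← Real.rpow_neg ht0.le,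
        show (2 - a) - 1 = 2 + -(1 + a) by ring, Real.rpow_add ht0]
      norm_cast
      ring
    rw [setIntegral_congr_fun measurableSet_Ioi this, integral_const_mul,
      Real.integral_rpow_mul_exp_neg_mul_Ioi (by linarith) hb, one_div, Real.inv_rpow hb.le,
      ← Real.rpow_neg hb.le]
    ring_nf
  rw [hL, hR] at hsw
  linarith

/-- The ray `b + [0,∞)` stays away from `0` and its points grow linearly. The bound is uniform near
`b`, as domination under the integral sign requires. -/
theorem exists_le_norm_add_of_mem_slitPlane {b : ℂ} (hb : b ∈ Complex.slitPlane) :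
    ∃ c : ℝ, 0 < c ∧ ∀ w ∈ Metric.ball b c, ∀ u : ℝ, 0 ≤ u → c * (u + 1) ≤ ‖(u : ℂ) + w‖ := by
  obtain ⟨δ, hδ, hδb⟩ : ∃ δ : ℝ, 0 < δ ∧ ∀ u : ℝ, 0 ≤ u → δ ≤ ‖(u : ℂ) + b‖ := by
    rcases Complex.mem_slitPlane_iff.1 hb with h | h
    · refine ⟨b.re, h, fun u hu => ?_⟩
      refine le_trans ?_ (Complex.re_le_norm _)
      simpa using hu
    · refine ⟨|b.im|, abs_pos.2 h, fun u _ => ?_⟩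
      simpa using Complex.abs_im_le_norm ((u : ℂ) + b)
  have hpos : 0 < δ + ‖b‖ + 1 := by positivity
  -- Twice this constant works at `b` itself; moving from `b` to `w` loses at most half of it,
  -- because `u + 1 ≥ 1`.
  refine ⟨δ / (δ + ‖b‖ + 1) / 2, by positivity, fun w hw u hu => ?_⟩
  have h1 : u ≤ ‖(u : ℂ) + b‖ + ‖b‖ := by
    have := norm_sub_le ((u : ℂ) + b) b
    rwa [add_sub_cancel_right, Complex.norm_real, Real.norm_of_nonneg hu] at this
  have h2 : δ / (δ + ‖b‖ + 1) * (u + 1) ≤ ‖(u : ℂ) + b‖ := by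
    rw [div_mul_eq_mul_div, div_le_iff₀ hpos]
    nlinarith [hδb u hu, norm_nonneg b, mul_le_mul_of_nonneg_right (hδb u hu) (norm_nonneg b)]
  have h3 : ‖(u : ℂ) + b‖ ≤ ‖(u : ℂ) + w‖ + ‖w - b‖ := by
    have := norm_sub_le ((u : ℂ) + w) (w - b)
    rwa [show (u : ℂ) + w - (w - b) = u + b by ring] at this
  have h4 : ‖w - b‖ < δ / (δ + ‖b‖ + 1) / 2 := by simpa [dist_eq_norm] using hw
  have h5 : 0 < δ / (δ + ‖b‖ + 1) := by positivity
  nlinarith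

theorem differentiableOn_integral_rpow_div_add_pow_three {a : ℝ} (ha : -1 < a) (ha2 : a < 2) :
    DifferentiableOn ℂ (fun b : ℂ => ∫ u in Ioi (0 : ℝ), ((u ^ a : ℝ) : ℂ) / ((u : ℂ) + b) ^ 3)
      Complex.slitPlane := by
  intro b hb
  apply DifferentiableAt.differentiableWithinAt
  obtain ⟨c, hc, hcb⟩ := exists_le_norm_add_of_mem_slitPlane hb
  have hI := integrableOn_rpow_div_add_pow_three ha ha2 one_pos
  have hmeas : ∀ w : ℂ, AEStronglyMeasurable
      (fun u : ℝ => ((u ^ a : ℝ) : ℂ) / ((u : ℂ) + w) ^ 3) (volume.restrict (Ioi 0)) := by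
    intro w
    apply Measurable.aestronglyMeasurable
    fun_prop
  have key := hasDerivAt_integral_of_dominated_loc_of_deriv_le
    (μ := volume.restrict (Ioi (0 : ℝ))) (s := Metric.ball b c)
    (F := fun (w : ℂ) (u : ℝ) => ((u ^ a : ℝ) : ℂ) / ((u : ℂ) + w) ^ 3)
    (F' := fun (w : ℂ) (u : ℝ) => ((u ^ a : ℝ) : ℂ) * (-3 / ((u : ℂ) + w) ^ 4))
    (bound := fun u : ℝ => 3 / c ^ 4 * (u ^ a / (u + 1) ^ 3)) (x₀ := b)
    (Metric.ball_mem_nhds b hc) (Eventually.of_forall hmeas) ?_ ?_ ?_ (hI.const_mul _) ?_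
  · exact key.2.differentiableAt
  · refine Integrable.mono' (hI.const_mul (1 / c ^ 3)) (hmeas b) ?_
    refine (ae_restrict_iff' measurableSet_Ioi).2 (Eventually.of_forall fun u hu => ?_)
    have hu0 : (0 : ℝ) < u := hu
    have h := hcb b (Metric.mem_ball_self hc) u hu0.le
    rw [norm_div, norm_pow, Complex.norm_real, Real.norm_of_nonneg (by positivity),
      div_mul_div_comm, one_mul, ← mul_pow]
    gcongr
  · apply Measurable.aestronglyMeasurable
    fun_prop
  · refine (ae_restrict_iff' measurableSet_Ioi).2 (Eventually.of_forall fun u hu w hw => ?_)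
    have hu0 : (0 : ℝ) < u := hu
    have h := hcb w hw u hu0.le
    rw [norm_mul, norm_div, norm_pow, Complex.norm_real, Real.norm_of_nonneg (by positivity),
      norm_neg, Complex.norm_ofNat]
    calc u ^ a * (3 / ‖(u : ℂ) + w‖ ^ 4) ≤ u ^ a * (3 / (c * (u + 1)) ^ 4) := by gcongr
      _ ≤ u ^ a * (3 / (c ^ 4 * (u + 1) ^ 3)) := by
        rw [mul_pow]
        gcongr <;> linarith
      _ = _ := by
        have : u + 1 ≠ 0 := by positivity
        field_simp
  · refine (ae_restrict_iff' measurableSet_Ioi).2 (Eventually.of_forall fun u hu w hw => ?_)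
    have hu0 : (0 : ℝ) < u := hu
    have h := hcb w hw u hu0.le
    have hne : (u : ℂ) + w ≠ 0 := by
      rw [← norm_pos_iff]
      exact lt_of_lt_of_le (by positivity) h
    have h1 : HasDerivAt (fun w : ℂ => ((u : ℂ) + w) ^ 3) (3 * ((u : ℂ) + w) ^ 2) w := by
      simpa using ((hasDerivAt_id w).const_add (u : ℂ)).fun_pow 3
    have h2 := (h1.inv (pow_ne_zero 3 hne)).const_mul ((u ^ a : ℝ) : ℂ)
    refine h2.congr_deriv ?_
    field_simp

/-- Both sides are holomorphic on the slit plane and agree at the real points `1 + 1/(n+1)`, which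
accumulate at `1`. -/
theorem integral_rpow_div_add_pow_three_complex {a : ℝ} (ha : -1 < a) (ha2 : a < 2) {b : ℂ}
    (hb : b ∈ Complex.slitPlane) :
    ∫ u in Ioi (0 : ℝ), ((u ^ a : ℝ) : ℂ) / ((u : ℂ) + b) ^ 3 =
      ((Real.Gamma (1 + a) * Real.Gamma (2 - a) / 2 : ℝ) : ℂ) * b ^ ((a - 2 : ℝ) : ℂ) := by
  have hL := (differentiableOn_integral_rpow_div_add_pow_three ha ha2).analyticOnNhd
    Complex.isOpen_slitPlane
  have hR : AnalyticOnNhd ℂ (fun b : ℂ =>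
      ((Real.Gamma (1 + a) * Real.Gamma (2 - a) / 2 : ℝ) : ℂ) * b ^ ((a - 2 : ℝ) : ℂ))
      Complex.slitPlane := by
    refine DifferentiableOn.analyticOnNhd (fun w hw => ?_) Complex.isOpen_slitPlane
    exact ((differentiableAt_id.cpow_const hw).const_mul _).differentiableWithinAt
  refine hL.eqOn_of_preconnected_of_frequently_eq hR ?_ Complex.one_mem_slitPlane ?_ hb
  · exact (Complex.starConvex_one_slitPlane.isPathConnected
      Complex.one_mem_slitPlane).isConnected.isPreconnected
  · have ht : Tendsto (fun n : ℕ => ((1 + 1 / ((n : ℝ) + 1) : ℝ) : ℂ)) atTop (𝓝[≠] 1) := by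
      refine tendsto_nhdsWithin_iff.2 ⟨?_, Eventually.of_forall fun n => ?_⟩
      · have := (tendsto_one_div_add_atTop_nhds_zero_nat (𝕜 := ℝ)).const_add 1
        rw [add_zero] at this
        have h2 := (Complex.continuous_ofReal.tendsto 1).comp this
        rwa [Complex.ofReal_one] at h2
      · have : (0 : ℝ) < 1 / ((n : ℝ) + 1) := by positivity
        simp only [mem_compl_iff, mem_singleton_iff]
        rw [← Complex.ofReal_one, Complex.ofReal_inj]
        linarith
    refine ht.frequently (Frequently.of_forall fun n => ?_)
    set x : ℝ := 1 + 1 / ((n : ℝ) + 1) with hx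
    have hx0 : 0 < x := by positivity
    have h := integral_rpow_div_add_pow_three ha ha2 hx0
    rw [← Complex.ofReal_cpow hx0.le, ← Complex.ofReal_mul, ← h, ← integral_complex_ofReal]
    norm_cast

end FGN

/-! ### The polylogarithm: power series and bilateral sum -/

namespace FGN

open MeasureTheory Set

theorem polylog_eq_integral_exp (s : ℝ) (z : ℂ) :
    polylog s z = ((1 / Real.Gamma (s + 2) : ℝ) : ℂ) *
      ∫ u in Ioi (0 : ℝ), ((u ^ (s + 1) : ℝ) : ℂ) *
        (Complex.exp u * (z * (Complex.exp u + z)) / (Complex.exp u - z) ^ 3) := by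
  have himg : Real.exp '' Ioi 0 = Ioi 1 := by
    ext x
    constructor
    · rintro ⟨u, hu, rfl⟩
      exact Real.one_lt_exp_iff.2 hu
    · intro hx
      exact ⟨Real.log x, Real.log_pos hx, Real.exp_log (lt_trans one_pos hx)⟩
  rw [polylog, ← himg, integral_image_eq_integral_abs_deriv_smul measurableSet_Ioi
    (fun x _ => (Real.hasDerivAt_exp x).hasDerivWithinAt) Real.exp_injective.injOn]
  congr 1
  refine setIntegral_congr_fun measurableSet_Ioi fun u _ => ?_
  simp only [Real.log_exp, abs_of_pos (Real.exp_pos u), Complex.real_smul, Complex.ofReal_exp]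
  ring

/-- From `n² = 2 C(n+2,2) - 3 C(n+1,1) + C(n,0)` and the binomial series. -/
theorem hasSum_sq_mul_geometric {q : ℂ} (hq : ‖q‖ < 1) :
    HasSum (fun n : ℕ => (n : ℂ) ^ 2 * q ^ n) (q * (1 + q) / (1 - q) ^ 3) := by
  have h2 := (hasSum_choose_mul_geometric_of_norm_lt_one 2 hq).mul_left 2
  have h1 := (hasSum_choose_mul_geometric_of_norm_lt_one 1 hq).mul_left 3
  have h0 := hasSum_choose_mul_geometric_of_norm_lt_one 0 hq
  have hne : (1 : ℂ) - q ≠ 0 := by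
    intro h
    rw [sub_eq_zero] at h
    rw [← h] at hq
    simp at hq
  convert! (h2.sub h1).add h0 using 1
  · funext n
    have : (((n + 2).choose 2 : ℕ) : ℂ) = (n + 2) * (n + 1) / 2 := by
      rw [Nat.cast_choose_two]
      push_cast
      ring
    rw [this]
    simp
    ring
  · field_simp
    ring

/-- The kernel expands as `∑ n² (z e^{-u})^n`, and each term integrates to `n² n^{-s-2} Γ(s+2) z^n`.
Since `s > -2`, the norms are dominated by `n² ‖z‖^n`. -/
theorem hasSum_polylog {s : ℝ} (hs : -2 < s) {z : ℂ} (hz : ‖z‖ < 1) :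
    HasSum (fun k : ℕ => ((((k : ℝ) + 1) ^ (-s) : ℝ) : ℂ) * z ^ (k + 1)) (polylog s z) := by
  set F : ℕ → ℝ → ℂ := fun k u =>
    ((((k : ℝ) + 1) ^ 2 : ℝ) : ℂ) * z ^ (k + 1) *
      ((u ^ (s + 2 - 1) * Real.exp (-(((k : ℝ) + 1) * u)) : ℝ) : ℂ) with hF
  have hG : 0 < Real.Gamma (s + 2) := Real.Gamma_pos_of_pos (by linarith)
  have hI : ∀ k : ℕ, ∫ u in Ioi (0 : ℝ), u ^ (s + 2 - 1) * Real.exp (-(((k : ℝ) + 1) * u)) =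
      (1 / ((k : ℝ) + 1)) ^ (s + 2) * Real.Gamma (s + 2) := fun k =>
    Real.integral_rpow_mul_exp_neg_mul_Ioi (by linarith) (by positivity)
  have hInt : ∀ k : ℕ, IntegrableOn
      (fun u : ℝ => u ^ (s + 2 - 1) * Real.exp (-(((k : ℝ) + 1) * u))) (Ioi 0) := by
    intro k
    by_contra hn
    have h0 := hI k
    rw [integral_undef hn] at h0
    have : 0 < (1 / ((k : ℝ) + 1)) ^ (s + 2) * Real.Gamma (s + 2) := by positivity
    linarith
  have hk : ∀ k : ℕ, ((k : ℝ) + 1) ^ 2 * (1 / ((k : ℝ) + 1)) ^ (s + 2) = ((k : ℝ) + 1) ^ (-s) := by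
    intro k
    have h1 : (0 : ℝ) < k + 1 := by positivity
    rw [one_div, Real.inv_rpow h1.le, ← Real.rpow_neg h1.le, ← Real.rpow_natCast,
      ← Real.rpow_add h1]
    congr 1
    push_cast
    ring
  have hFint : ∀ k, ∫ u in Ioi (0 : ℝ), F k u =
      (Real.Gamma (s + 2) : ℂ) * (((((k : ℝ) + 1) ^ (-s) : ℝ) : ℂ) * z ^ (k + 1)) := by
    intro k
    simp only [hF]
    rw [integral_const_mul, integral_complex_ofReal, hI, ← hk]
    push_cast
    ring
  have hFnorm : ∀ k, ∫ u in Ioi (0 : ℝ), ‖F k u‖ =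
      Real.Gamma (s + 2) * (((k : ℝ) + 1) ^ (-s) * ‖z‖ ^ (k + 1)) := by
    intro k
    have : ∀ u ∈ Ioi (0 : ℝ), ‖F k u‖ = ((k : ℝ) + 1) ^ 2 * ‖z‖ ^ (k + 1) *
        (u ^ (s + 2 - 1) * Real.exp (-(((k : ℝ) + 1) * u))) := by
      intro u hu
      have hu0 : (0 : ℝ) < u := hu
      simp only [hF]
      rw [norm_mul, norm_mul, norm_pow, Complex.norm_real, Complex.norm_real,
        Real.norm_of_nonneg (by positivity), Real.norm_of_nonneg (by positivity)]
    rw [setIntegral_congr_fun measurableSet_Ioi this, integral_const_mul, hI, ← hk]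
    ring
  have hsum : Summable fun k => ∫ u in Ioi (0 : ℝ), ‖F k u‖ := by
    simp_rw [hFnorm]
    apply Summable.mul_left
    have h2 : Summable fun k : ℕ => ((k : ℝ) ^ 2 * ‖z‖ ^ k) :=
      summable_pow_mul_geometric_of_norm_lt_one 2 (by simpa using hz)
    have h3 := (summable_nat_add_iff 1).2 h2
    refine Summable.of_nonneg_of_le (fun k => by positivity) (fun k => ?_) h3
    push_cast
    gcongr
    rw [← Real.rpow_natCast]
    apply Real.rpow_le_rpow_of_exponent_le
    · linarith [(Nat.cast_nonneg k : (0 : ℝ) ≤ k)]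
    · push_cast
      linarith
  have key := hasSum_integral_of_summable_integral_norm (μ := volume.restrict (Ioi (0 : ℝ)))
    (F := F) (fun k => (hInt k).ofReal.const_mul _) hsum
  have hval : ∫ u in Ioi (0 : ℝ), ∑' k, F k u = ∫ u in Ioi (0 : ℝ), ((u ^ (s + 1) : ℝ) : ℂ) *
        (Complex.exp u * (z * (Complex.exp u + z)) / (Complex.exp u - z) ^ 3) := by
    refine setIntegral_congr_fun measurableSet_Ioi fun u hu => ?_
    have hu0 : (0 : ℝ) < u := hu
    have he : ‖Complex.exp (-u)‖ < 1 := by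
      rw [Complex.norm_exp]
      simpa using hu0
    have hq : ‖z * Complex.exp (-u)‖ < 1 := by
      rw [norm_mul]
      exact mul_lt_one_of_nonneg_of_lt_one_left (norm_nonneg _) hz he.le
    -- The term `n = 0` vanishes, so dropping it aligns the series with indices `k + 1`.
    have h := ((hasSum_nat_add_iff' 1).2 (hasSum_sq_mul_geometric hq)).mul_left
      (((u ^ (s + 1) : ℝ) : ℂ))
    have hne : (1 : ℂ) - z * Complex.exp (-u) ≠ 0 := by
      intro h
      rw [sub_eq_zero] at h
      rw [← h] at hq
      simp at hq
    have heu : Complex.exp u - z = Complex.exp u * (1 - z * Complex.exp (-u)) := by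
      rw [mul_sub, Complex.exp_neg]
      field_simp [Complex.exp_ne_zero]
    rw [heu]
    convert h.tsum_eq using 1
    · congr 1
      funext k
      simp only [hF]
      rw [mul_pow z, ← Complex.exp_nat_mul, show s + 2 - 1 = s + 1 by ring]
      push_cast
      rw [show (((k : ℂ) + 1) * -(u : ℂ)) = -(((k : ℂ) + 1) * u) by ring]
      ring
    · rw [Finset.sum_range_one]
      rw [Complex.exp_neg] at hne ⊢
      have := Complex.exp_ne_zero (u : ℂ)
      field_simp
      simp
      ring
  rw [hval] at key
  have h := key.mul_left ((1 / Real.Gamma (s + 2) : ℝ) : ℂ)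
  rw [← polylog_eq_integral_exp] at h
  convert! h using 1
  funext k
  rw [hFint, ← mul_assoc]
  push_cast
  rw [one_div_mul_cancel (by exact_mod_cast hG.ne'), one_mul]

/-- This is Lipschitz's formula at `τ = iv/2π`, which lies in the upper half-plane exactly when `Re
v > 0`; the nome is `e^{-v}`. -/
theorem tsum_two_div_add_int_pow_three_of_re_pos {v : ℂ} (hv : 0 < v.re) :
    ∑' k : ℤ, 2 / (v + 2 * Real.pi * Complex.I * k) ^ 3 =
      Complex.exp v * (Complex.exp v + 1) / (Complex.exp v - 1) ^ 3 := by
  have hpi : (Real.pi : ℂ) ≠ 0 := by exact_mod_cast Real.pi_ne_zero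
  set τ : ℂ := Complex.I * v / (2 * Real.pi) with hτ
  have him : 0 < τ.im := by
    have : τ = Complex.I * v / ((2 * Real.pi : ℝ) : ℂ) := by rw [hτ]; push_cast; rfl
    rw [this, Complex.div_ofReal_im]
    simp only [Complex.mul_im, Complex.I_re, Complex.I_im, zero_mul, one_mul, zero_add]
    positivity
  have h := EisensteinSeries.qExpansion_identity (k := 2) one_le_two ⟨τ, him⟩
  have hexp : Complex.exp (2 * Real.pi * Complex.I * τ) = Complex.exp (-v) := by
    congr 1
    rw [hτ]
    field_simp
    rw [Complex.I_sq]
    ring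
  have hq : ‖Complex.exp (-v)‖ < 1 := by
    rw [Complex.norm_exp]
    simpa using hv
  simp only [hexp] at h
  rw [(hasSum_sq_mul_geometric hq).tsum_eq] at h
  have hne : Complex.exp v - 1 ≠ 0 := by
    intro h0
    rw [sub_eq_zero] at h0
    rw [Complex.exp_neg, h0] at hq
    simp at hq
  have hterm : ∀ k : ℤ, 2 / (v + 2 * Real.pi * Complex.I * k) ^ 3 =
      2 * (Complex.I / (2 * Real.pi)) ^ 3 * (1 / (τ + ((-k : ℤ) : ℂ)) ^ (2 + 1)) := by
    intro k
    have : τ + ((-k : ℤ) : ℂ) =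
        Complex.I / (2 * Real.pi) * (v + 2 * Real.pi * Complex.I * k) := by
      rw [hτ]
      push_cast
      field_simp
      linear_combination (-2 * (Real.pi : ℂ) * k) * Complex.I_sq
    have hc : (Complex.I / (2 * Real.pi)) ^ 3 ≠ 0 := by simp [hpi]
    rw [this, mul_pow, mul_one_div, mul_comm 2 ((Complex.I / (2 * (Real.pi : ℂ))) ^ 3),
      mul_div_mul_left _ _ hc]
  simp_rw [hterm]
  have hneg := (Equiv.neg ℤ).tsum_eq (fun k : ℤ => 1 / (τ + (k : ℂ)) ^ (2 + 1))
  simp only [Equiv.neg_apply] at hneg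
  rw [tsum_mul_left, hneg, h,
    Complex.exp_neg]
  have h1 : (1 : ℂ) - (Complex.exp v)⁻¹ = (Complex.exp v - 1) / Complex.exp v := by
    field_simp [Complex.exp_ne_zero]
  rw [h1]
  have he := Complex.exp_ne_zero v
  field_simp
  norm_num [Nat.factorial]
  ring_nf
  rw [Complex.I_pow_four]
  ring

/-- Both sides are odd in `v`, which reduces `Re v < 0` to `Re v > 0`. -/
theorem tsum_two_div_add_int_pow_three {v : ℂ} (hv : v.re ≠ 0) :
    ∑' k : ℤ, 2 / (v + 2 * Real.pi * Complex.I * k) ^ 3 =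
      Complex.exp v * (Complex.exp v + 1) / (Complex.exp v - 1) ^ 3 := by
  rcases hv.lt_or_gt with h | h
  · have hn := tsum_two_div_add_int_pow_three_of_re_pos (v := -v) (by simpa using h)
    have hterm : ∀ k : ℤ, 2 / (v + 2 * Real.pi * Complex.I * k) ^ 3 =
        -(2 / (-v + 2 * Real.pi * Complex.I * ((-k : ℤ) : ℂ)) ^ 3) := by
      intro k
      rw [show -v + 2 * Real.pi * Complex.I * ((-k : ℤ) : ℂ) =
        -(v + 2 * Real.pi * Complex.I * k) by push_cast; ring, Odd.neg_pow (by decide), div_neg,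
        neg_neg]
    simp_rw [hterm]
    have hneg := (Equiv.neg ℤ).tsum_eq
      (fun k : ℤ => 2 / (-v + 2 * Real.pi * Complex.I * (k : ℂ)) ^ 3)
    simp only [Equiv.neg_apply] at hneg
    rw [tsum_neg, hneg, hn, Complex.exp_neg]
    have he := Complex.exp_ne_zero v
    have hne : Complex.exp v - 1 ≠ 0 := by
      intro h0
      rw [sub_eq_zero] at h0
      have : ‖Complex.exp v‖ < 1 := by
        rw [Complex.norm_exp]
        simpa using h
      rw [h0] at this
      simp at this
    have hne' : 1 - Complex.exp v ≠ 0 := by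
      rw [← neg_sub]; exact neg_ne_zero.2 hne
    have h1 : (Complex.exp v)⁻¹ - 1 = -((Complex.exp v - 1) / Complex.exp v) := by
      field_simp [Complex.exp_ne_zero]
      ring
    rw [h1]
    field_simp
    ring
  · exact tsum_two_div_add_int_pow_three_of_re_pos h

theorem summable_abs_two_pi_mul_int_add_rpow {r : ℝ} (hr : r < -1) (x : ℝ) :
    Summable fun k : ℤ => |x + 2 * Real.pi * k| ^ r := by
  have h := (Real.summable_one_div_int_add_rpow (x / (2 * Real.pi)) (-r)).2 (by linarith)
  refine (h.mul_left ((2 * Real.pi) ^ r)).congr fun k => ?_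
  have : x + 2 * Real.pi * k = 2 * Real.pi * (k + x / (2 * Real.pi)) := by
    field_simp
    ring
  rw [this, abs_mul, Real.mul_rpow (abs_nonneg _) (abs_nonneg _),
    abs_of_pos (by positivity : 0 < 2 * Real.pi), Real.rpow_neg (abs_nonneg _), one_div, inv_inv]

/-- Insert the partial fractions of the kernel and integrate termwise. The strip condition keeps
every pole parameter `b k` at a fixed distance from the real axis, hence in the slit plane. -/
theorem hasSum_polylog_exp {s : ℝ} (hs : -2 < s) (hs0 : s < 0) {w : ℂ} (hw : 0 < w.im)
    (hw2 : w.im < 2 * Real.pi) :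
    HasSum (fun k : ℤ => (Real.Gamma (1 - s) : ℂ) *
      (-w + 2 * Real.pi * Complex.I * k) ^ ((s - 1 : ℝ) : ℂ)) (polylog s (Complex.exp w)) := by
  set b : ℤ → ℂ := fun k => -w + 2 * Real.pi * Complex.I * k with hb
  have hbim : ∀ k, (b k).im = -w.im + 2 * Real.pi * k := by
    intro k
    simp [hb]
  obtain ⟨δ, hδ, hδb⟩ : ∃ δ : ℝ, 0 < δ ∧ ∀ k, δ ≤ |(b k).im| := by
    refine ⟨min w.im (2 * Real.pi - w.im), lt_min hw (by linarith), fun k => ?_⟩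
    rw [hbim]
    rcases le_or_gt k 0 with hk | hk
    · refine le_trans (min_le_left _ _) (le_trans ?_ (neg_le_abs _))
      have : (k : ℝ) ≤ 0 := by exact_mod_cast hk
      nlinarith [Real.pi_pos]
    · refine le_trans (min_le_right _ _) (le_trans ?_ (le_abs_self _))
      have : (1 : ℝ) ≤ k := by exact_mod_cast hk
      nlinarith [Real.pi_pos]
  have hslit : ∀ k, b k ∈ Complex.slitPlane := fun k =>
    Complex.mem_slitPlane_iff.2 (Or.inr (abs_pos.1 (lt_of_lt_of_le hδ (hδb k))))
  -- One norm bounds `|Im b k|`, another bounds `u` up to `|Re w|`, and `|Re w|` is at most `|Re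
  -- w|/δ` norms. The constant does not depend on `k`, so the norms of the integrals are summable.
  set C : ℝ := 2 + |w.re| / δ with hC
  have hC0 : 0 < C := by positivity
  have hlow : ∀ k, ∀ u : ℝ, 0 < u → u + |(b k).im| ≤ C * ‖(u : ℂ) + b k‖ := by
    intro k u hu
    have h1 : |(b k).im| ≤ ‖(u : ℂ) + b k‖ := by
      simpa using Complex.abs_im_le_norm ((u : ℂ) + b k)
    have h2 : u ≤ ‖(u : ℂ) + b k‖ + |w.re| := by
      have h3 := Complex.abs_re_le_norm ((u : ℂ) + b k)
      have h4 : ((u : ℂ) + b k).re = u - w.re := by simp [hb, sub_eq_add_neg]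
      rw [h4] at h3
      linarith [le_abs_self (u - w.re), le_abs_self w.re]
    have h5 : |w.re| ≤ |w.re| / δ * ‖(u : ℂ) + b k‖ := by
      rw [div_mul_eq_mul_div, le_div_iff₀ hδ]
      gcongr
      exact (hδb k).trans h1
    rw [hC]
    linarith
  have hG : 0 < Real.Gamma (s + 2) := Real.Gamma_pos_of_pos (by linarith)
  set F : ℤ → ℝ → ℂ := fun k u => 2 * (((u ^ (s + 1) : ℝ) : ℂ) / ((u : ℂ) + b k) ^ 3) with hF
  have hle : ∀ k, ∀ u ∈ Ioi (0 : ℝ),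
      ‖F k u‖ ≤ 2 * C ^ 3 * (u ^ (s + 1) / (u + |(b k).im|) ^ 3) := by
    intro k u hu
    have hu0 : (0 : ℝ) < u := hu
    have h := hlow k u hu0
    have hpos : 0 < u + |(b k).im| := by positivity
    simp only [hF]
    rw [norm_mul, norm_div, norm_pow, Complex.norm_real, Real.norm_of_nonneg (by positivity),
      Complex.norm_ofNat, mul_assoc]
    gcongr
    rw [div_le_iff₀ (pow_pos (pos_of_mul_pos_right (lt_of_lt_of_le hpos h) hC0.le) 3),
      mul_assoc, div_mul_eq_mul_div, mul_div_assoc', le_div_iff₀ (pow_pos hpos 3)]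
    calc u ^ (s + 1) * (u + |(b k).im|) ^ 3 ≤ u ^ (s + 1) * (C * ‖(u : ℂ) + b k‖) ^ 3 := by gcongr
      _ = _ := by ring
  have hint : ∀ k, IntegrableOn (F k) (Ioi 0) := by
    intro k
    refine Integrable.mono' ((integrableOn_rpow_div_add_pow_three (a := s + 1) (by linarith)
      (by linarith) (lt_of_lt_of_le hδ (hδb k))).const_mul (2 * C ^ 3)) ?_
      ((ae_restrict_iff' measurableSet_Ioi).2 (Eventually.of_forall (hle k)))
    apply Measurable.aestronglyMeasurable
    fun_prop
  have hsum : Summable fun k => ∫ u in Ioi (0 : ℝ), ‖F k u‖ := by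
    have h := (summable_abs_two_pi_mul_int_add_rpow (r := s + 1 - 2) (by linarith)
      (-w.im)).mul_left (2 * C ^ 3 * (Real.Gamma (1 + (s + 1)) * Real.Gamma (2 - (s + 1)) / 2))
    refine Summable.of_nonneg_of_le (fun k => integral_nonneg fun u => norm_nonneg _)
      (fun k => ?_) h
    refine (setIntegral_mono_on (hint k).norm ((integrableOn_rpow_div_add_pow_three (a := s + 1)
      (by linarith) (by linarith) (lt_of_lt_of_le hδ (hδb k))).const_mul (2 * C ^ 3))
      measurableSet_Ioi (hle k)).trans ?_
    rw [integral_const_mul, integral_rpow_div_add_pow_three (by linarith) (by linarith)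
      (lt_of_lt_of_le hδ (hδb k)), hbim, mul_assoc (2 * C ^ 3)]
  have key := hasSum_integral_of_summable_integral_norm (μ := volume.restrict (Ioi (0 : ℝ)))
    (F := F) hint hsum
  have hval : ∫ u in Ioi (0 : ℝ), ∑' k, F k u = ∫ u in Ioi (0 : ℝ), ((u ^ (s + 1) : ℝ) : ℂ) *
        (Complex.exp u * (Complex.exp w * (Complex.exp u + Complex.exp w)) /
          (Complex.exp u - Complex.exp w) ^ 3) := by
    refine integral_congr_ae ?_
    -- The partial fraction formula was proved off `Re v = 0`; this omits a single `u`.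
    have hae : ∀ᵐ u : ℝ ∂(volume.restrict (Ioi (0 : ℝ))), u ≠ w.re :=
      ae_restrict_of_ae (Measure.ae_ne volume w.re)
    filter_upwards [hae] with u hu
    have h := tsum_two_div_add_int_pow_three (v := u - w) (by simpa [sub_eq_zero] using hu)
    have hFk : ∀ k, F k u =
        ((u ^ (s + 1) : ℝ) : ℂ) * (2 / ((u : ℂ) - w + 2 * Real.pi * Complex.I * k) ^ 3) := by
      intro k
      simp only [hF, hb]
      rw [show (u : ℂ) + (-w + 2 * Real.pi * Complex.I * k) =
        (u : ℂ) - w + 2 * Real.pi * Complex.I * k by ring]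
      ring
    simp_rw [hFk]
    rw [tsum_mul_left, h, Complex.exp_sub]
    congr 1
    have he := Complex.exp_ne_zero w
    have h1 : Complex.exp u / Complex.exp w - 1 =
        (Complex.exp u - Complex.exp w) / Complex.exp w := by
      field_simp
    have hne : Complex.exp u - Complex.exp w ≠ 0 := by
      intro h0
      rw [sub_eq_zero] at h0
      have := congrArg norm h0
      rw [Complex.norm_exp, Complex.norm_exp, Real.exp_eq_exp] at this
      exact hu (by simpa using this)
    rw [h1]
    field_simp
  rw [hval] at key
  have h := key.mul_left ((1 / Real.Gamma (s + 2) : ℝ) : ℂ)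
  rw [← polylog_eq_integral_exp] at h
  convert! h using 1
  funext k
  simp only [hF]
  rw [integral_const_mul, integral_rpow_div_add_pow_three_complex (by linarith) (by linarith)
    (hslit k), show s + 1 - 2 = s - 1 by ring, show 2 - (s + 1) = 1 - s by ring,
    show 1 + (s + 1) = s + 2 by ring]
  have hG' : (Real.Gamma (s + 2) : ℂ) ≠ 0 := by exact_mod_cast hG.ne'
  push_cast
  field_simp
  rfl

end FGN

/-! ### The lattice sum and its asymptotics in the right half-plane -/

noncomputable section

namespace FGN

open Set

/-- The sum `∑_{k ≥ 0} (ζ + 2πk)^p`, a rescaled Hurwitz zeta function in its second variable. -/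
def latticeSum (p : ℝ) (ζ : ℂ) : ℂ := ∑' k : ℕ, (ζ + 2 * Real.pi * k) ^ (p : ℂ)

theorem add_re_le_norm (ζ : ℂ) (k : ℕ) : ζ.re + 2 * Real.pi * k ≤ ‖ζ + 2 * Real.pi * k‖ := by
  refine le_trans (le_of_eq ?_) (Complex.re_le_norm _)
  simp

theorem summable_add_two_pi_mul_nat_rpow {p ε : ℝ} (hp : p < -1) (hε : 0 < ε) :
    Summable fun k : ℕ => (ε + 2 * Real.pi * k) ^ p := by
  have h := (summable_abs_two_pi_mul_int_add_rpow hp ε).comp_injective Nat.cast_injective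
  refine h.congr fun k => ?_
  simp only [Function.comp_apply, Int.cast_natCast]
  rw [abs_of_pos (by positivity)]

theorem norm_latticeSum_term_le {p ε : ℝ} (hp : p < -1) (hε : 0 < ε) {ζ : ℂ} (hζ : ε ≤ ζ.re)
    (k : ℕ) : ‖(ζ + 2 * Real.pi * k) ^ (p : ℂ)‖ ≤ (ε + 2 * Real.pi * k) ^ p := by
  rw [Complex.norm_cpow_real]
  refine Real.rpow_le_rpow_of_nonpos (by positivity) ?_ (by linarith)
  linarith [add_re_le_norm ζ k]

theorem summable_latticeSum {p : ℝ} (hp : p < -1) {ζ : ℂ} (hζ : 0 ≤ ζ.re) :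
    Summable fun k : ℕ => (ζ + 2 * Real.pi * k) ^ (p : ℂ) := by
  -- On the imaginary axis the term `k = 0` lacks the uniform bound; all later terms have real part
  -- at least `2πk`.
  rw [← summable_nat_add_iff 1]
  refine Summable.of_norm_bounded
    (summable_add_two_pi_mul_nat_rpow hp (by positivity : 0 < 2 * Real.pi)) fun k => ?_
  have h := norm_latticeSum_term_le hp (by positivity : 0 < 2 * Real.pi)
    (ζ := ζ + 2 * Real.pi) (by simpa using hζ) k
  convert! h using 3
  push_cast
  ring

theorem norm_latticeSum_le {p ε : ℝ} (hp : p < -1) (hε : 0 < ε) {ζ : ℂ} (hζ : ε ≤ ζ.re) :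
    ‖latticeSum p ζ‖ ≤ ∑' k : ℕ, (ε + 2 * Real.pi * k) ^ p :=
  tsum_of_norm_bounded (summable_add_two_pi_mul_nat_rpow hp hε).hasSum
    (norm_latticeSum_term_le hp hε hζ)

theorem latticeSum_eq_add {p : ℝ} (hp : p < -1) {ζ : ℂ} (hζ : 0 ≤ ζ.re) :
    latticeSum p ζ = ζ ^ (p : ℂ) + latticeSum p (ζ + 2 * Real.pi) := by
  rw [latticeSum, (summable_latticeSum hp hζ).tsum_eq_zero_add, latticeSum]
  congr 1
  · simp
  · congr 1
    funext k
    push_cast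
    ring_nf

theorem add_mem_slitPlane {ζ : ℂ} (hζ : 0 ≤ ζ.re) (h0 : ζ ≠ 0) {x : ℝ} (hx : 0 ≤ x) :
    ζ + x ∈ Complex.slitPlane := by
  rw [Complex.mem_slitPlane_iff]
  by_contra! h
  obtain ⟨h1, h2⟩ := h
  simp only [Complex.add_re, Complex.ofReal_re, Complex.add_im, Complex.ofReal_im, add_zero] at h1 h2
  exact h0 (Complex.ext (by simp; linarith) (by simpa using h2))

theorem differentiableAt_latticeSum {p : ℝ} (hp : p < -1) {ζ : ℂ} (hζ : 0 < ζ.re) :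
    DifferentiableAt ℂ (latticeSum p) ζ := by
  have hopen : IsOpen {w : ℂ | ζ.re / 2 < w.re} := isOpen_lt continuous_const Complex.continuous_re
  have hmem : ζ ∈ {w : ℂ | ζ.re / 2 < w.re} := by simpa using hζ
  refine (Complex.differentiableOn_tsum_of_summable_norm
    (summable_add_two_pi_mul_nat_rpow hp (half_pos hζ)) (fun k w hw => ?_) hopen
    fun k w hw => norm_latticeSum_term_le hp (half_pos hζ) (le_of_lt hw) k).differentiableAt
    (hopen.mem_nhds hmem)
  have hw' : 0 < w.re := lt_trans (half_pos hζ) hw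
  have hs : w + 2 * Real.pi * k ∈ Complex.slitPlane := by
    have := add_mem_slitPlane hw'.le (by rintro rfl; simp at hw')
      (by positivity : 0 ≤ 2 * Real.pi * k)
    simpa using this
  exact ((differentiableAt_id.add_const _).cpow_const hs).differentiableWithinAt

theorem latticeSum_conj {p : ℝ} {ζ : ℂ} (hζ : 0 < ζ.re) :
    latticeSum p (conj ζ) = conj (latticeSum p ζ) := by
  rw [latticeSum, latticeSum, Complex.conj_tsum]
  congr 1
  funext k
  have hs : ζ + 2 * Real.pi * k ∈ Complex.slitPlane := by
    have := add_mem_slitPlane hζ.le (by rintro rfl; simp at hζ)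
      (by positivity : 0 ≤ 2 * Real.pi * k)
    simpa using this
  have h := Complex.conj_cpow _ (p : ℂ) (Complex.mem_slitPlane_iff_arg.1 hs).1
  rw [Complex.conj_ofReal] at h
  rw [← h]
  simp [Complex.conj_ofNat]

/-- The cross term in `‖ζ+x‖²` is nonnegative, so `‖ζ+x‖² ≥ ‖ζ‖² + x² ≥ (‖ζ‖+x)²/2`. -/
theorem half_norm_add_le {ζ : ℂ} (hζ : 0 ≤ ζ.re) {x : ℝ} (hx : 0 ≤ x) :
    (‖ζ‖ + x) / 2 ≤ ‖ζ + x‖ := by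
  have h1 : ‖ζ + x‖ ^ 2 = ‖ζ‖ ^ 2 + 2 * x * ζ.re + x ^ 2 := by
    rw [Complex.sq_norm, Complex.sq_norm, Complex.normSq_apply, Complex.normSq_apply]
    simp
    ring
  have h2 : 0 ≤ x * ζ.re := mul_nonneg hx hζ
  refine (sq_le_sq₀ (by positivity) (norm_nonneg _)).1 ?_
  nlinarith [sq_nonneg (‖ζ‖ - x), sq_nonneg (‖ζ‖), sq_nonneg x]

theorem norm_le_norm_add {ζ : ℂ} (hζ : 0 ≤ ζ.re) {x : ℝ} (hx : 0 ≤ x) : ‖ζ‖ ≤ ‖ζ + x‖ := by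
  have h1 : ‖ζ + x‖ ^ 2 = ‖ζ‖ ^ 2 + 2 * x * ζ.re + x ^ 2 := by
    rw [Complex.sq_norm, Complex.sq_norm, Complex.normSq_apply, Complex.normSq_apply]
    simp
    ring
  have h2 : 0 ≤ x * ζ.re := mul_nonneg hx hζ
  refine (sq_le_sq₀ (by positivity) (norm_nonneg _)).1 ?_
  nlinarith

/-- A telescoping majorant from the mean value theorem; the factor `2^q` comes from the intermediate
point being below `x + 1 ≤ 2x`. -/
theorem rpow_le_mul_rpow_sub_rpow {q x : ℝ} (hq : q < -1) (hx : 1 ≤ x) :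
    x ^ q ≤ 1 / (-(q + 1) * 2 ^ q) * (x ^ (q + 1) - (x + 1) ^ (q + 1)) := by
  obtain ⟨c, hc, h⟩ := exists_hasDerivAt_eq_slope (fun t : ℝ => t ^ (q + 1))
    (fun t : ℝ => (q + 1) * t ^ q) (lt_add_one x)
    (continuousOn_id.rpow_const fun t ht => Or.inl (by
      have := ht.1
      simp only [id]
      linarith))
    (fun t ht => by
      have := Real.hasDerivAt_rpow_const (x := t) (p := q + 1)
        (Or.inl (by have := ht.1; linarith))
      simpa using this)
  have hc0 : 0 < c := by linarith [hc.1]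
  have h2 : (2 * x) ^ q ≤ c ^ q :=
    Real.rpow_le_rpow_of_nonpos hc0 (by linarith [hc.2]) (by linarith)
  rw [Real.mul_rpow (by norm_num) (by linarith)] at h2
  rw [add_sub_cancel_left, div_one] at h
  have h3 : (0 : ℝ) < 2 ^ q := by positivity
  have h4 : 0 < -(q + 1) := by linarith
  rw [one_div_mul_eq_div, le_div_iff₀ (by positivity)]
  nlinarith

theorem summable_add_nat_rpow_and_tsum_le {q x : ℝ} (hq : q < -1) (hx : 1 ≤ x) :
    Summable (fun k : ℕ => (x + k) ^ q) ∧
      ∑' k : ℕ, (x + k) ^ q ≤ 1 / (-(q + 1) * 2 ^ q) * x ^ (q + 1) := by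
  have hC : 0 ≤ 1 / (-(q + 1) * (2 : ℝ) ^ q) := by
    have : 0 < -(q + 1) := by linarith
    positivity
  have hb : ∀ n : ℕ, ∑ k ∈ Finset.range n, (x + k) ^ q ≤
      1 / (-(q + 1) * 2 ^ q) * x ^ (q + 1) := by
    intro n
    have h1 : ∀ k ∈ Finset.range n, (x + k) ^ q ≤ 1 / (-(q + 1) * 2 ^ q) *
        ((x + k) ^ (q + 1) - (x + (k + 1 : ℕ)) ^ (q + 1)) := by
      intro k _
      have := rpow_le_mul_rpow_sub_rpow (x := x + k) hq
        (by linarith [(Nat.cast_nonneg k : (0 : ℝ) ≤ k)])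
      rwa [add_assoc, ← Nat.cast_add_one] at this
    refine (Finset.sum_le_sum h1).trans ?_
    rw [← Finset.mul_sum, Finset.sum_range_sub' (fun k : ℕ => (x + k) ^ (q + 1))]
    gcongr
    have : 0 ≤ (x + n) ^ (q + 1) := by positivity
    simp only [Nat.cast_zero, add_zero]
    linarith
  have hnn : ∀ k : ℕ, 0 ≤ (x + k) ^ q := fun k => by positivity
  exact ⟨summable_of_sum_range_le hnn hb, Real.tsum_le_of_sum_range_le hnn hb⟩

/-- The norms `‖ζ + 2πk‖^q` add up to `O(‖ζ‖^(q+1))` in the closed right half-plane. -/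
theorem exists_tsum_norm_rpow_le {q : ℝ} (hq : q < -1) :
    ∃ C : ℝ, 0 < C ∧ ∀ ζ : ℂ, 0 ≤ ζ.re → 1 ≤ ‖ζ‖ →
      Summable (fun k : ℕ => ‖ζ + 2 * Real.pi * k‖ ^ q) ∧
        ∑' k : ℕ, ‖ζ + 2 * Real.pi * k‖ ^ q ≤ C * ‖ζ‖ ^ (q + 1) := by
  have h4 : 0 < -(q + 1) := by linarith
  refine ⟨2 ^ (-q) * (1 / (-(q + 1) * 2 ^ q)), by positivity, fun ζ hζ h1 => ?_⟩
  obtain ⟨hs, ht⟩ := summable_add_nat_rpow_and_tsum_le hq h1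
  have hle : ∀ k : ℕ, ‖ζ + 2 * Real.pi * k‖ ^ q ≤ 2 ^ (-q) * (‖ζ‖ + k) ^ q := by
    intro k
    have h := half_norm_add_le hζ (by positivity : 0 ≤ 2 * Real.pi * (k : ℝ))
    have hk : (k : ℝ) ≤ 2 * Real.pi * k := by
      have := Real.pi_gt_three
      nlinarith [(Nat.cast_nonneg k : (0 : ℝ) ≤ k)]
    have h2 : (‖ζ‖ + k) / 2 ≤ ‖ζ + 2 * Real.pi * k‖ := by
      push_cast at h
      linarith
    have h3 := Real.rpow_le_rpow_of_nonpos (by positivity) h2 (by linarith : q ≤ 0)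
    rwa [Real.div_rpow (by positivity) (by norm_num), div_eq_inv_mul,
      ← Real.rpow_neg (by norm_num)] at h3
  have hsum := Summable.of_nonneg_of_le (fun k => by positivity) hle (hs.mul_left _)
  refine ⟨hsum, (hsum.tsum_le_tsum hle (hs.mul_left _)).trans ?_⟩
  rw [tsum_mul_left, mul_assoc]
  gcongr

theorem exists_norm_latticeSum_le {p : ℝ} (hp : p < -1) :
    ∃ C : ℝ, 0 < C ∧ ∀ ζ : ℂ, 0 ≤ ζ.re → 1 ≤ ‖ζ‖ → ‖latticeSum p ζ‖ ≤ C * ‖ζ‖ ^ (p + 1) := by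
  obtain ⟨C, hC, h⟩ := exists_tsum_norm_rpow_le hp
  refine ⟨C, hC, fun ζ hζ h1 => ?_⟩
  obtain ⟨hs, ht⟩ := h ζ hζ h1
  refine (tsum_of_norm_bounded hs.hasSum fun k => ?_).trans ht
  rw [Complex.norm_cpow_real]

/-- A primitive of `-(1/2π) ζ^p`. -/
def latticePrimitive (p : ℝ) (ζ : ℂ) : ℂ :=
  -(ζ ^ ((p + 1 : ℝ) : ℂ) / (2 * Real.pi * (p + 1)))

/-- The difference of primitives is the mean of `(ζ+x)^p` over `0 ≤ x ≤ 2π`. Norms do not decrease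
along this segment, so the derivative of the power is at most `|p| ‖ζ‖^{p-1}`. Two mean value
inequalities replace the integral. -/
theorem norm_latticePrimitive_sub_sub_le {p : ℝ} (hp : p < -1) {ζ : ℂ} (hζ : 0 ≤ ζ.re)
    (h0 : ζ ≠ 0) :
    ‖latticePrimitive p ζ - latticePrimitive p (ζ + 2 * Real.pi) - ζ ^ (p : ℂ)‖ ≤
      2 * Real.pi * |p| * ‖ζ‖ ^ (p - 1) := by
  have hpi : (Real.pi : ℂ) ≠ 0 := by exact_mod_cast Real.pi_ne_zero
  have hp1 : (p : ℂ) + 1 ≠ 0 := by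
    have : p + 1 ≠ 0 := by linarith
    exact_mod_cast this
  have hz : 0 < ‖ζ‖ := norm_pos_iff.2 h0
  have hadd : ∀ x : ℝ, HasDerivAt (fun x : ℝ => ζ + x) 1 x := fun x =>
    (Complex.ofRealCLM.hasDerivAt (x := x)).const_add ζ
  have hder : ∀ c : ℂ, ∀ x : ℝ, 0 ≤ x →
      HasDerivAt (fun x : ℝ => (ζ + x) ^ c) (c * (ζ + x) ^ (c - 1)) x := by
    intro c x hx
    have h1 : HasDerivAt (fun w : ℂ => w ^ c) (c * (ζ + x) ^ (c - 1)) (ζ + x) := by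
      simpa using (hasDerivAt_id (ζ + x)).cpow_const (add_mem_slitPlane hζ h0 hx)
    simpa only [one_smul, Function.comp_def] using h1.scomp x (hadd x)
  have hψ : ∀ x ∈ Icc (0 : ℝ) (2 * Real.pi),
      ‖(ζ + x) ^ (p : ℂ) - ζ ^ (p : ℂ)‖ ≤ |p| * ‖ζ‖ ^ (p - 1) * (2 * Real.pi) := by
    intro x hx
    have h := norm_image_sub_le_of_norm_deriv_le_segment' (a := 0) (b := 2 * Real.pi)
      (f := fun x : ℝ => (ζ + x) ^ (p : ℂ)) (C := |p| * ‖ζ‖ ^ (p - 1))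
      (fun y hy => (hder p y hy.1).hasDerivWithinAt) (fun y hy => ?_) x hx
    · simp only [Complex.ofReal_zero, add_zero, sub_zero] at h
      refine h.trans ?_
      gcongr
      exact hx.2
    · rw [norm_mul, Complex.norm_real, Real.norm_eq_abs, ← Complex.ofReal_one,
        ← Complex.ofReal_sub, Complex.norm_cpow_real]
      exact mul_le_mul_of_nonneg_left (Real.rpow_le_rpow_of_nonpos hz
        (norm_le_norm_add hζ hy.1) (by linarith)) (abs_nonneg _)
  have h := norm_image_sub_le_of_norm_deriv_le_segment' (a := 0) (b := 2 * Real.pi)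
    (f := fun x : ℝ => (ζ + x) ^ ((p : ℂ) + 1) / (2 * Real.pi * (p + 1)) -
      x * (ζ ^ (p : ℂ) / (2 * Real.pi)))
    (f' := fun x : ℝ => ((ζ + x) ^ (p : ℂ) - ζ ^ (p : ℂ)) / (2 * Real.pi))
    (C := |p| * ‖ζ‖ ^ (p - 1)) (fun y hy => ?_) (fun y hy => ?_) (2 * Real.pi)
    ⟨by positivity, le_rfl⟩
  · rw [sub_zero] at h
    convert! h using 1
    · congr 1
      rw [latticePrimitive, latticePrimitive]
      push_cast
      field_simp
      simp
      ring
    · ring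
  · have h1 := (hder ((p : ℂ) + 1) y hy.1).div_const (2 * Real.pi * (p + 1))
    have h2 : HasDerivAt (fun x : ℝ => (x : ℂ) * (ζ ^ (p : ℂ) / (2 * Real.pi)))
        (1 * (ζ ^ (p : ℂ) / (2 * Real.pi))) y :=
      (Complex.ofRealCLM.hasDerivAt (x := y)).mul_const _
    refine ((h1.sub h2).congr_deriv ?_).hasDerivWithinAt
    rw [add_sub_cancel_right]
    field_simp
  · rw [norm_div, div_le_iff₀ (by simp [Real.pi_ne_zero])]
    refine (hψ y ⟨hy.1, hy.2.le⟩).trans (le_of_eq ?_)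
    simp [abs_of_pos Real.pi_pos]

/-- Leading asymptotics of `latticeSum` in the closed right half-plane. -/
theorem exists_norm_latticeSum_sub_le {p : ℝ} (hp : p < -1) :
    ∃ C : ℝ, 0 < C ∧ ∀ ζ : ℂ, 0 ≤ ζ.re → 1 ≤ ‖ζ‖ →
      ‖latticePrimitive p ζ - latticeSum p ζ‖ ≤ C * ‖ζ‖ ^ p := by
  obtain ⟨C, hC, h⟩ := exists_tsum_norm_rpow_le (q := p - 1) (by linarith)
  have hp0 : 0 < |p| := abs_pos.2 (by linarith)
  refine ⟨2 * Real.pi * |p| * C, by positivity, fun ζ hζ h1 => ?_⟩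
  obtain ⟨hs, ht⟩ := h ζ hζ h1
  rw [sub_add_cancel] at ht
  have hζ0 : ζ ≠ 0 := by
    rintro rfl
    simp at h1
    linarith
  set d : ℕ → ℂ := fun k => latticePrimitive p (ζ + 2 * Real.pi * k) -
    latticePrimitive p (ζ + 2 * Real.pi * (k + 1 : ℕ)) with hd
  have hle : ∀ k : ℕ, ‖d k - (ζ + 2 * Real.pi * k) ^ (p : ℂ)‖ ≤
      2 * Real.pi * |p| * ‖ζ + 2 * Real.pi * k‖ ^ (p - 1) := by
    intro k
    have hre : 0 ≤ (ζ + 2 * Real.pi * k).re := by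
      have : (ζ + 2 * Real.pi * k).re = ζ.re + 2 * Real.pi * k := by simp
      rw [this]
      positivity
    have hne : ζ + 2 * Real.pi * k ≠ 0 := by
      have := Complex.slitPlane_ne_zero
        (add_mem_slitPlane hζ hζ0 (by positivity : 0 ≤ 2 * Real.pi * (k : ℝ)))
      simpa using this
    have := norm_latticePrimitive_sub_sub_le hp hre hne
    convert! this using 4
    push_cast
    ring_nf
  have hsum1 : Summable fun k : ℕ => d k - (ζ + 2 * Real.pi * k) ^ (p : ℂ) :=
    Summable.of_norm_bounded (hs.mul_left _) hle
  have hsK := summable_latticeSum hp hζ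
  have hsd : Summable d := by
    simpa using hsum1.add hsK
  -- The differences telescope, and the far end vanishes because `p + 1 < 0`.
  have htd : ∑' k, d k = latticePrimitive p ζ := by
    refine tendsto_nhds_unique hsd.hasSum.tendsto_sum_nat ?_
    have hsumr : ∀ n : ℕ, ∑ k ∈ Finset.range n, d k =
        latticePrimitive p ζ - latticePrimitive p (ζ + 2 * Real.pi * n) := by
      intro n
      simp only [hd]
      rw [Finset.sum_range_sub' (fun k : ℕ => latticePrimitive p (ζ + 2 * Real.pi * k))]
      simp
    simp_rw [hsumr]
    suffices Tendsto (fun n : ℕ => latticePrimitive p (ζ + 2 * Real.pi * n)) atTop (𝓝 0) by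
      simpa using this.const_sub (latticePrimitive p ζ)
    have hinf : Tendsto (fun n : ℕ => ‖ζ + 2 * Real.pi * n‖) atTop atTop := by
      refine tendsto_atTop_mono (fun n => ?_) tendsto_natCast_atTop_atTop
      refine le_trans ?_ (add_re_le_norm ζ n)
      have := Real.pi_gt_three
      nlinarith [(Nat.cast_nonneg n : (0 : ℝ) ≤ n)]
    have hz := ((tendsto_rpow_neg_atTop (by linarith : 0 < -(p + 1))).comp hinf).div_const
      ‖(2 * Real.pi * (p + 1) : ℂ)‖
    rw [zero_div] at hz
    refine squeeze_zero_norm (fun n => le_of_eq ?_) hz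
    rw [latticePrimitive, norm_neg, norm_div, Complex.norm_cpow_real]
    simp
  rw [← htd, latticeSum, ← hsd.tsum_sub hsK]
  refine (tsum_of_norm_bounded (hs.mul_left (2 * Real.pi * |p|)).hasSum hle).trans ?_
  rw [tsum_mul_left, mul_assoc _ C]
  gcongr

end FGN

end

/-! ### Jonquière's formula, `Q` on the strip, and holomorphy -/

noncomputable section

namespace FGN

open Set MeasureTheory

theorem abs_arg_lt_of_re_pos {μ : ℂ} (h : 0 < μ.re) : |μ.arg| < Real.pi / 2 :=
  Complex.abs_arg_lt_pi_div_two_iff.2 (Or.inl h)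

/-- For `Re μ > 0` the argument is within `π/2` of `0`, so a quarter turn does not cross the branch
cut. -/
theorem I_mul_cpow {μ : ℂ} (h : 0 < μ.re) (c : ℂ) :
    (Complex.I * μ) ^ c = Complex.I ^ c * μ ^ c := by
  have h1 := abs_lt.1 (abs_arg_lt_of_re_pos h)
  have hμ : μ ≠ 0 := by rintro rfl; simp at h
  rw [Complex.cpow_def_of_ne_zero (mul_ne_zero Complex.I_ne_zero hμ),
    Complex.cpow_def_of_ne_zero Complex.I_ne_zero, Complex.cpow_def_of_ne_zero hμ,
    Complex.log_mul Complex.I_ne_zero hμ, add_mul, Complex.exp_add]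
  rw [Complex.arg_I]
  constructor <;> linarith [h1.1, h1.2, Real.pi_pos]

theorem neg_I_mul_cpow {μ : ℂ} (h : 0 < μ.re) (c : ℂ) :
    (-Complex.I * μ) ^ c = (-Complex.I) ^ c * μ ^ c := by
  have h1 := abs_lt.1 (abs_arg_lt_of_re_pos h)
  have hμ : μ ≠ 0 := by rintro rfl; simp at h
  have hI : -Complex.I ≠ 0 := neg_ne_zero.2 Complex.I_ne_zero
  rw [Complex.cpow_def_of_ne_zero (mul_ne_zero hI hμ), Complex.cpow_def_of_ne_zero hI,
    Complex.cpow_def_of_ne_zero hμ, Complex.log_mul hI hμ, add_mul, Complex.exp_add]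
  rw [Complex.arg_neg_I]
  constructor <;> linarith [h1.1, h1.2, Real.pi_pos]

theorem I_cpow_ofReal (p : ℝ) : Complex.I ^ (p : ℂ) = Complex.exp ((Real.pi * p / 2 : ℝ) * Complex.I) := by
  rw [Complex.cpow_def_of_ne_zero Complex.I_ne_zero, Complex.log_I]
  congr 1
  push_cast
  ring

theorem neg_I_cpow_ofReal (p : ℝ) :
    (-Complex.I) ^ (p : ℂ) = Complex.exp (-((Real.pi * p / 2 : ℝ) * Complex.I)) := by
  rw [Complex.cpow_def_of_ne_zero (neg_ne_zero.2 Complex.I_ne_zero), Complex.log_neg_I]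
  congr 1
  push_cast
  ring

theorem I_cpow_add_neg_I_cpow (p : ℝ) :
    (-Complex.I) ^ (p : ℂ) + Complex.I ^ (p : ℂ) = (2 * Real.cos (Real.pi * p / 2) : ℝ) := by
  rw [I_cpow_ofReal, neg_I_cpow_ofReal]
  push_cast
  rw [Complex.two_cos]
  ring_nf

/-- Jonquière's formula on the strip `0 < Re l < 2π`. -/
theorem polylog_exp_I_mul {s : ℝ} (hs : -2 < s) (hs0 : s < 0) {l : ℂ} (hl : 0 < l.re)
    (hl2 : l.re < 2 * Real.pi) :
    polylog s (Complex.exp (Complex.I * l)) = Real.Gamma (1 - s) *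
      ((-Complex.I) ^ ((s - 1 : ℝ) : ℂ) * latticeSum (s - 1) l +
        Complex.I ^ ((s - 1 : ℝ) : ℂ) * latticeSum (s - 1) (2 * Real.pi - l)) := by
  have h := hasSum_polylog_exp hs hs0 (w := Complex.I * l) (by simpa using hl) (by simpa using hl2)
  -- After `k ↦ -k`, indices `k ≥ 0` give `-i(l+2πk)` and indices `-(k+1)` give `i(2π-l+2πk)`.
  have h' := (Equiv.neg ℤ).hasSum_iff.2 h
  refine HasSum.unique h' ?_
  rw [mul_add, ← mul_assoc, ← mul_assoc]
  have hre : 0 < (2 * Real.pi - l : ℂ).re := by simpa using hl2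
  refine HasSum.of_nat_of_neg_add_one ?_ ?_
  · have := (summable_latticeSum (p := s - 1) (by linarith) hl.le).hasSum.mul_left
      (Real.Gamma (1 - s) * (-Complex.I) ^ ((s - 1 : ℝ) : ℂ))
    refine this.congr_fun fun k => ?_
    have hk : 0 < (l + 2 * Real.pi * k).re := by
      have : (l + 2 * Real.pi * k).re = l.re + 2 * Real.pi * k := by simp
      rw [this]
      positivity
    simp only [Function.comp_apply, Equiv.neg_apply]
    rw [mul_assoc (Real.Gamma (1 - s) : ℂ), ← neg_I_mul_cpow hk]
    congr 2
    push_cast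
    ring
  · have := (summable_latticeSum (p := s - 1) (by linarith) hre.le).hasSum.mul_left
      (Real.Gamma (1 - s) * Complex.I ^ ((s - 1 : ℝ) : ℂ))
    refine this.congr_fun fun k => ?_
    have hk : 0 < (2 * Real.pi - l + 2 * Real.pi * k).re := by
      have : (2 * Real.pi - l + 2 * Real.pi * k).re =
        (2 * Real.pi - l : ℂ).re + 2 * Real.pi * k := by simp
      rw [this]
      positivity
    simp only [Function.comp_apply, Equiv.neg_apply]
    rw [mul_assoc (Real.Gamma (1 - s) : ℂ), ← I_mul_cpow hk]
    congr 2
    simp only [neg_neg]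
    push_cast
    ring

/-- The constant `c(d) = Γ(2d+2) cos(πd) / 2π` of the spectral density. -/
def densityConst (d : ℝ) : ℝ := 1 / (2 * Real.pi) * Real.Gamma (2 * d + 2) * Real.cos (Real.pi * d)

theorem densityConst_pos {d : ℝ} (hd : d ∈ Ioo (-(1 / 2) : ℝ) (1 / 2)) : 0 < densityConst d := by
  have h1 : 0 < Real.Gamma (2 * d + 2) := Real.Gamma_pos_of_pos (by linarith [hd.1])
  have h2 : 0 < Real.cos (Real.pi * d) := by
    apply Real.cos_pos_of_mem_Ioo
    constructor <;> nlinarith [hd.1, hd.2, Real.pi_pos]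
  unfold densityConst
  positivity

/-- Inversion of `z` is `l ↦ 2π - l`, which swaps the two lattice sums. Each then has the
coefficient `(-i)^p + i^p = 2 cos(πp/2) = -2 cos(πd)`. -/
theorem Q_exp_I_mul {d : ℝ} (hd : d ∈ Ioo (-(1 / 2) : ℝ) (1 / 2)) {l : ℂ} (hl : 0 < l.re)
    (hl2 : l.re < 2 * Real.pi) {z : ℂ} (hz : Complex.exp (Complex.I * l) = z) :
    Q d z = -(densityConst d) * (z⁻¹ - 2 + z) *
      (latticeSum (-2 * d - 2) l + latticeSum (-2 * d - 2) (2 * Real.pi - l)) := by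
  have hinv : z⁻¹ = Complex.exp (Complex.I * (2 * Real.pi - l)) := by
    rw [← hz, mul_sub, Complex.exp_sub, mul_comm Complex.I (2 * Real.pi), Complex.exp_two_pi_mul_I,
      one_div]
  have h1 := polylog_exp_I_mul (s := -2 * d - 1) (by linarith [hd.2]) (by linarith [hd.1]) hl hl2
  have h2 := polylog_exp_I_mul (s := -2 * d - 1) (by linarith [hd.2]) (by linarith [hd.1])
    (l := 2 * Real.pi - l) (by simpa using hl2) (by simpa using hl)
  rw [hz] at h1
  rw [← hinv, sub_sub_cancel] at h2
  have hc := I_cpow_add_neg_I_cpow (-2 * d - 1 - 1)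
  have hcos : Real.cos (Real.pi * (-2 * d - 1 - 1) / 2) = -Real.cos (Real.pi * d) := by
    rw [show Real.pi * (-2 * d - 1 - 1) / 2 = -(Real.pi * d + Real.pi) by ring, Real.cos_neg,
      Real.cos_add_pi]
  rw [hcos] at hc
  rw [show -2 * d - 1 - 1 = -2 * d - 2 by ring, show 1 - (-2 * d - 1) = 2 * d + 2 by ring] at h1 h2
  rw [show -2 * d - 1 - 1 = -2 * d - 2 by ring] at hc
  have hpi : (Real.pi : ℂ) ≠ 0 := by exact_mod_cast Real.pi_ne_zero
  rw [Q, h1, h2, densityConst]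
  set A := latticeSum (-2 * d - 2) l
  set B := latticeSum (-2 * d - 2) (2 * Real.pi - l)
  have hsum : (Real.Gamma (2 * d + 2) : ℂ) *
      ((-Complex.I) ^ ((-2 * d - 2 : ℝ) : ℂ) * A + Complex.I ^ ((-2 * d - 2 : ℝ) : ℂ) * B) +
      Real.Gamma (2 * d + 2) *
      ((-Complex.I) ^ ((-2 * d - 2 : ℝ) : ℂ) * B + Complex.I ^ ((-2 * d - 2 : ℝ) : ℂ) * A) =
      Real.Gamma (2 * d + 2) * (2 * -Real.cos (Real.pi * d) : ℝ) * (A + B) := by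
    rw [← hc]
    ring
  rw [hsum]
  push_cast
  field_simp
  ring

theorem mem_cutPlane_Ici_zero {z : ℂ} : z ∈ cutPlane (Ici 0) ↔ -z ∈ Complex.slitPlane := by
  rw [Complex.mem_slitPlane_iff, cutPlane, mem_compl_iff, mem_image]
  constructor
  · intro h
    by_contra! hc
    simp only [Complex.neg_re, Complex.neg_im, neg_eq_zero] at hc
    exact h ⟨z.re, by simpa using hc.1, Complex.ext (by simp) (by simp [hc.2])⟩
  · rintro h ⟨x, hx, rfl⟩
    have hx0 : (0 : ℝ) ≤ x := hx
    rcases h with h | h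
    · simp at h
      linarith
    · simp at h

theorem isOpen_cutPlane_Ici_zero : IsOpen (cutPlane (Ici 0)) := by
  have : cutPlane (Ici 0) = (fun z : ℂ => -z) ⁻¹' Complex.slitPlane := by
    ext z
    exact mem_cutPlane_Ici_zero
  rw [this]
  exact Complex.isOpen_slitPlane.preimage continuous_neg

theorem mem_cutPlane_of_im_ne_zero {z : ℂ} (hz : z.im ≠ 0) : z ∈ cutPlane (Ici 0) :=
  mem_cutPlane_Ici_zero.2 (Complex.mem_slitPlane_iff.2 (Or.inr (by simpa using hz)))

theorem inv_mem_cutPlane {z : ℂ} (hz : z ∈ cutPlane (Ici 0)) : z⁻¹ ∈ cutPlane (Ici 0) := by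
  rw [mem_cutPlane_Ici_zero] at hz ⊢
  rw [Complex.mem_slitPlane_iff_arg] at hz ⊢
  rw [← inv_neg, Complex.arg_inv, if_neg hz.1]
  refine ⟨fun h => ?_, inv_ne_zero hz.2⟩
  linarith [Complex.neg_pi_lt_arg (-z)]

/-- The logarithm with cut along `[0, ∞)`, divided by `i`; it maps the cut plane to the strip
`0 < Re l < 2π`. -/
def angle (z : ℂ) : ℂ := Real.pi - Complex.I * Complex.log (-z)

theorem exp_I_mul_angle {z : ℂ} (hz : z ∈ cutPlane (Ici 0)) :
    Complex.exp (Complex.I * angle z) = z := by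
  have h0 := Complex.slitPlane_ne_zero (mem_cutPlane_Ici_zero.1 hz)
  rw [angle, show Complex.I * (Real.pi - Complex.I * Complex.log (-z)) =
    Real.pi * Complex.I - Complex.I ^ 2 * Complex.log (-z) by ring, Complex.I_sq, neg_one_mul,
    sub_neg_eq_add, Complex.exp_add, Complex.exp_pi_mul_I, Complex.exp_log h0]
  ring

theorem angle_re (z : ℂ) : (angle z).re = Real.pi + (-z).arg := by
  simp [angle, Complex.log_im]

theorem angle_im (z : ℂ) : (angle z).im = -Real.log ‖z‖ := by
  simp [angle, Complex.log_re]

theorem angle_re_pos (z : ℂ) : 0 < (angle z).re := by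
  rw [angle_re]
  linarith [Complex.neg_pi_lt_arg (-z)]

theorem angle_re_lt {z : ℂ} (hz : z ∈ cutPlane (Ici 0)) : (angle z).re < 2 * Real.pi := by
  rw [angle_re]
  have h := Complex.mem_slitPlane_iff_arg.1 (mem_cutPlane_Ici_zero.1 hz)
  linarith [lt_of_le_of_ne (Complex.arg_le_pi (-z)) h.1]

theorem differentiableAt_angle {z : ℂ} (hz : z ∈ cutPlane (Ici 0)) :
    DifferentiableAt ℂ angle z := by
  unfold angle
  exact ((differentiableAt_id.neg.clog (mem_cutPlane_Ici_zero.1 hz)).const_mul _).const_sub _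

theorem differentiableAt_polylog_of_mem_cutPlane {s : ℝ} (hs : -2 < s) (hs0 : s < 0) {z : ℂ}
    (hz : z ∈ cutPlane (Ici 0)) : DifferentiableAt ℂ (polylog s) z := by
  have heq : polylog s =ᶠ[𝓝 z] fun z => Real.Gamma (1 - s) *
      ((-Complex.I) ^ ((s - 1 : ℝ) : ℂ) * latticeSum (s - 1) (angle z) +
        Complex.I ^ ((s - 1 : ℝ) : ℂ) * latticeSum (s - 1) (2 * Real.pi - angle z)) := by
    filter_upwards [isOpen_cutPlane_Ici_zero.mem_nhds hz] with y hy
    have := polylog_exp_I_mul hs hs0 (angle_re_pos y) (angle_re_lt hy)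
    rwa [exp_I_mul_angle hy] at this
  refine DifferentiableAt.congr_of_eventuallyEq ?_ heq
  have h1 : DifferentiableAt ℂ (fun z => latticeSum (s - 1) (angle z)) z :=
    (differentiableAt_latticeSum (by linarith) (angle_re_pos z)).comp z (differentiableAt_angle hz)
  have h2 : DifferentiableAt ℂ (fun z => latticeSum (s - 1) (2 * Real.pi - angle z)) z :=
    DifferentiableAt.comp (g := latticeSum (s - 1)) z
      (differentiableAt_latticeSum (by linarith) (by simpa using angle_re_lt hz))
      ((differentiableAt_angle hz).const_sub _)
  exact ((h1.const_mul _).add (h2.const_mul _)).const_mul _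

theorem differentiableAt_polylog_of_norm_lt_one {s : ℝ} (hs : -2 < s) {z : ℂ} (hz : ‖z‖ < 1) :
    DifferentiableAt ℂ (polylog s) z := by
  obtain ⟨r, hr, hr1⟩ := exists_between hz
  have hr0 : 0 < r := lt_of_le_of_lt (norm_nonneg z) hr
  have hnr : ‖(r : ℂ)‖ = r := by rw [Complex.norm_real, Real.norm_of_nonneg hr0.le]
  have hsum := (hasSum_polylog hs (z := r) (by rwa [hnr])).summable.norm
  have hmem : Metric.ball (0 : ℂ) r ∈ 𝓝 z := Metric.isOpen_ball.mem_nhds (by simpa using hr)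
  have hd := (Complex.differentiableOn_tsum_of_summable_norm hsum
    (F := fun (k : ℕ) (z : ℂ) => ((((k : ℝ) + 1) ^ (-s) : ℝ) : ℂ) * z ^ (k + 1))
    (fun k => by fun_prop) Metric.isOpen_ball (fun k w hw => ?_)).differentiableAt hmem
  · refine hd.congr_of_eventuallyEq ?_
    filter_upwards [hmem] with y hy
    exact (hasSum_polylog hs (lt_trans (by simpa using hy) hr1)).tsum_eq.symm
  · rw [norm_mul, norm_mul, norm_pow, norm_pow, hnr]
    have : ‖w‖ < r := by simpa using hw
    gcongr

/-- The strip coordinate misses `[0,1)`, where the power series takes over. -/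
theorem differentiableOn_polylog {s : ℝ} (hs : -2 < s) (hs0 : s < 0) :
    DifferentiableOn ℂ (polylog s) (cutPlane (Ici 1)) := by
  intro z hz
  apply DifferentiableAt.differentiableWithinAt
  by_cases h : z ∈ cutPlane (Ici 0)
  · exact differentiableAt_polylog_of_mem_cutPlane hs hs0 h
  · simp only [cutPlane, mem_compl_iff, not_not] at h
    obtain ⟨x, hx, rfl⟩ := h
    refine differentiableAt_polylog_of_norm_lt_one hs ?_
    rw [Complex.norm_real, Real.norm_of_nonneg hx]
    by_contra! h1
    exact hz ⟨x, h1, rfl⟩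

theorem zero_ne_of_mem_cutPlane {z : ℂ} (hz : z ∈ cutPlane (Ici 0)) : z ≠ 0 := by
  rintro rfl
  exact hz ⟨0, mem_Ici.2 le_rfl, by simp⟩

theorem differentiableOn_Q {d : ℝ} (hd : d ∈ Ioo (-(1 / 2) : ℝ) (1 / 2)) :
    DifferentiableOn ℂ (Q d) (cutPlane (Ici 0)) := by
  intro z hz
  apply DifferentiableAt.differentiableWithinAt
  have h0 := zero_ne_of_mem_cutPlane hz
  have hinv : DifferentiableAt ℂ (fun z : ℂ => z⁻¹) z := differentiableAt_inv h0
  have h1 := differentiableAt_polylog_of_mem_cutPlane (s := -2 * d - 1) (by linarith [hd.2])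
    (by linarith [hd.1]) hz
  have h2 : DifferentiableAt ℂ (fun z => polylog (-2 * d - 1) z⁻¹) z :=
    (differentiableAt_polylog_of_mem_cutPlane (s := -2 * d - 1) (by linarith [hd.2])
      (by linarith [hd.1]) (inv_mem_cutPlane hz)).comp z hinv
  unfold Q
  exact (((hinv.sub_const 2).add differentiableAt_id).const_mul _).mul (h1.add h2)

theorem polylog_conj (s : ℝ) (z : ℂ) : polylog s (conj z) = conj (polylog s z) := by
  rw [polylog, polylog, map_mul, Complex.conj_ofReal, ← integral_conj]
  congr 2
  funext τ
  simp

theorem Q_conj (d : ℝ) (z : ℂ) : Q d (conj z) = conj (Q d z) := by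
  have h := polylog_conj (-2 * d - 1) z⁻¹
  rw [map_inv₀] at h
  rw [Q, Q, polylog_conj, h]
  simp [Complex.conj_ofNat]

theorem Q_inv (d : ℝ) (z : ℂ) : Q d z⁻¹ = Q d z := by
  rw [Q, Q, inv_inv]
  ring

end FGN

end

/-! ### Boundary values on the cut and growth at `0`, `1`, `∞` -/

noncomputable section

namespace FGN

open Set

/-- The function `l ↦ Q(e^{il})` near the upper edge of the cut, continued across it. -/
def edgeQ (d : ℝ) (l : ℂ) : ℂ :=
  -(densityConst d) * ((Complex.exp (Complex.I * l))⁻¹ - 2 + Complex.exp (Complex.I * l)) *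
    (l ^ ((-2 * d - 2 : ℝ) : ℂ) + (latticeSum (-2 * d - 2) (l + 2 * Real.pi) +
      latticeSum (-2 * d - 2) (2 * Real.pi - l)))

theorem Q_exp_eq_edgeQ {d : ℝ} (hd : d ∈ Ioo (-(1 / 2) : ℝ) (1 / 2)) {l : ℂ} (hl : 0 < l.re)
    (hl2 : l.re < 2 * Real.pi) : Q d (Complex.exp (Complex.I * l)) = edgeQ d l := by
  rw [Q_exp_I_mul hd hl hl2 rfl, latticeSum_eq_add (by linarith [hd.1]) hl.le, add_assoc, edgeQ]

theorem exp_I_mul_neg_I_mul_log {z : ℂ} (hz : z ≠ 0) :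
    Complex.exp (Complex.I * (-Complex.I * Complex.log z)) = z := by
  rw [← mul_assoc, mul_neg, Complex.I_mul_I, neg_neg, one_mul, Complex.exp_log hz]

theorem neg_I_mul_log_re (z : ℂ) : (-Complex.I * Complex.log z).re = z.arg := by
  simp [Complex.log_im]

theorem arg_pos_of_im_pos {z : ℂ} (hz : 0 < z.im) : 0 < z.arg := by
  refine lt_of_le_of_ne (Complex.arg_nonneg_iff.2 hz.le) fun h => ?_
  have := (Complex.arg_eq_zero_iff.1 h.symm).2
  linarith

theorem ne_zero_of_im_pos {z : ℂ} (hz : 0 < z.im) : z ≠ 0 := by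
  rintro rfl
  simp at hz

theorem Q_eq_edgeQ_log {d : ℝ} (hd : d ∈ Ioo (-(1 / 2) : ℝ) (1 / 2)) {z : ℂ} (hz : 0 < z.im) :
    Q d z = edgeQ d (-Complex.I * Complex.log z) := by
  have h := Q_exp_eq_edgeQ hd (l := -Complex.I * Complex.log z)
    (by rw [neg_I_mul_log_re]; exact arg_pos_of_im_pos hz)
    (by rw [neg_I_mul_log_re]; linarith [Complex.arg_le_pi z, Real.pi_pos])
  rwa [exp_I_mul_neg_I_mul_log (ne_zero_of_im_pos hz)] at h

/-- The two shifted sums are holomorphic for `|Re l| < 2π`; only `l^p` needs the slit plane. The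
edge of the cut becomes the imaginary axis, where `l = 0` alone, that is `t = 1`, is excluded. -/
theorem differentiableAt_edgeQ {d : ℝ} (hd : d ∈ Ioo (-(1 / 2) : ℝ) (1 / 2)) {l : ℂ}
    (hl : -(2 * Real.pi) < l.re) (hl2 : l.re < 2 * Real.pi) (hs : l ∈ Complex.slitPlane) :
    DifferentiableAt ℂ (edgeQ d) l := by
  have hp : -2 * d - 2 < -1 := by linarith [hd.1]
  have h1 : DifferentiableAt ℂ (fun l => latticeSum (-2 * d - 2) (l + 2 * Real.pi)) l :=
    DifferentiableAt.comp (g := latticeSum (-2 * d - 2)) l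
      (differentiableAt_latticeSum hp (by simp; linarith)) (differentiableAt_id.add_const _)
  have h2 : DifferentiableAt ℂ (fun l => latticeSum (-2 * d - 2) (2 * Real.pi - l)) l :=
    DifferentiableAt.comp (g := latticeSum (-2 * d - 2)) l
      (differentiableAt_latticeSum hp (by simp; linarith)) (differentiableAt_id.const_sub _)
  have he : DifferentiableAt ℂ (fun l => Complex.exp (Complex.I * l)) l := by fun_prop
  unfold edgeQ
  exact ((((he.inv (Complex.exp_ne_zero _)).sub_const 2).add he).const_mul _).mul
    ((differentiableAt_id.cpow_const hs).add (h1.add h2))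

instance nhdsAbove_neBot (t : ℝ) : (nhdsAbove t).NeBot := by
  rw [nhdsAbove, ← mem_closure_iff_nhdsWithin_neBot, Complex.closure_setOfPred_lt_im]
  simp

instance nhdsBelow_neBot (t : ℝ) : (nhdsBelow t).NeBot := by
  rw [nhdsBelow, ← mem_closure_iff_nhdsWithin_neBot, Complex.closure_setOfPred_im_lt]
  simp

theorem neg_I_mul_mem_slitPlane {y : ℝ} (hy : y ≠ 0) : -Complex.I * (y : ℂ) ∈ Complex.slitPlane :=
  Complex.mem_slitPlane_iff.2 (Or.inr (by simpa using hy))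

theorem differentiableAt_edgeQ_neg_I_mul {d : ℝ} (hd : d ∈ Ioo (-(1 / 2) : ℝ) (1 / 2)) {y : ℝ}
    (hy : y ≠ 0) : DifferentiableAt ℂ (edgeQ d) (-Complex.I * (y : ℂ)) := by
  refine differentiableAt_edgeQ hd ?_ ?_ (neg_I_mul_mem_slitPlane hy)
  · simp [Real.pi_pos]
  · simp [Real.pi_pos]

theorem tendsto_Q_nhdsAbove {d : ℝ} (hd : d ∈ Ioo (-(1 / 2) : ℝ) (1 / 2)) {t : ℝ} (ht : 0 < t)
    (h1 : t ≠ 1) :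
    Tendsto (Q d) (nhdsAbove t) (𝓝 (edgeQ d (-Complex.I * (Real.log t : ℂ)))) := by
  have hev : (fun z => edgeQ d (-Complex.I * Complex.log z)) =ᶠ[nhdsAbove t] Q d := by
    filter_upwards [self_mem_nhdsWithin] with z hz
    exact (Q_eq_edgeQ_log hd hz).symm
  refine Tendsto.congr' hev ?_
  have hlog : Tendsto (fun z => -Complex.I * Complex.log z) (nhdsAbove t)
      (𝓝 (-Complex.I * (Real.log t : ℂ))) := by
    rw [Complex.ofReal_log ht.le]
    have hc : ContinuousAt Complex.log t := continuousAt_clog (Complex.ofReal_mem_slitPlane.2 ht)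
    exact (hc.tendsto.mono_left nhdsWithin_le_nhds).const_mul _
  exact (differentiableAt_edgeQ_neg_I_mul hd
    (Real.log_ne_zero_of_pos_of_ne_one ht h1)).continuousAt.tendsto.comp hlog

theorem tendsto_conj_nhdsBelow (t : ℝ) :
    Tendsto (fun z : ℂ => conj z) (nhdsBelow t) (nhdsAbove t) := by
  refine tendsto_nhdsWithin_iff.2 ⟨?_, ?_⟩
  · have := (Complex.continuous_conj.tendsto (t : ℂ)).mono_left
      (nhdsWithin_le_nhds (s := {z : ℂ | z.im < 0}))
    simpa [nhdsBelow] using this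
  · filter_upwards [self_mem_nhdsWithin] with z hz
    have : z.im < 0 := hz
    simpa using this

theorem tendsto_inv_nhdsBelow {t : ℝ} (ht : 0 < t) :
    Tendsto (fun z : ℂ => z⁻¹) (nhdsBelow t⁻¹) (nhdsAbove t) := by
  refine tendsto_nhdsWithin_iff.2 ⟨?_, ?_⟩
  · have h0 : ((t⁻¹ : ℝ) : ℂ) ≠ 0 := by exact_mod_cast (inv_pos.2 ht).ne'
    have := (continuousAt_inv₀ h0).tendsto.mono_left
      (nhdsWithin_le_nhds (s := {z : ℂ | z.im < 0}))
    simpa [nhdsBelow] using this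
  · filter_upwards [self_mem_nhdsWithin] with z hz
    have h : z.im < 0 := hz
    have h0 : z ≠ 0 := by rintro rfl; simp at h
    simp only [Complex.inv_im]
    refine div_pos (by linarith) (Complex.normSq_pos.2 h0)

theorem tendsto_Q_nhdsBelow {d t : ℝ} {a : ℂ} (h : Tendsto (Q d) (nhdsAbove t) (𝓝 a)) :
    Tendsto (Q d) (nhdsBelow t) (𝓝 (conj a)) := by
  have := (Complex.continuous_conj.tendsto a).comp (h.comp (tendsto_conj_nhdsBelow t))
  refine this.congr fun z => ?_
  simp only [Function.comp_apply]
  rw [Q_conj, Complex.conj_conj]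

theorem tendsto_Q_nhdsBelow_inv {d t : ℝ} (ht : 0 < t) {a : ℂ}
    (h : Tendsto (Q d) (nhdsAbove t) (𝓝 a)) : Tendsto (Q d) (nhdsBelow t⁻¹) (𝓝 a) := by
  refine (h.comp (tendsto_inv_nhdsBelow ht)).congr fun z => ?_
  exact Q_inv d z

theorem Qplus_eq {d : ℝ} (hd : d ∈ Ioo (-(1 / 2) : ℝ) (1 / 2)) {t : ℝ} (ht : 0 < t)
    (h1 : t ≠ 1) : Qplus d t = edgeQ d (-Complex.I * (Real.log t : ℂ)) :=
  (tendsto_Q_nhdsAbove hd ht h1).limUnder_eq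

/-- Bound for `Q` near `1` in the upper half-plane. -/
theorem exists_norm_Q_le_near_one_of_im_pos {d : ℝ} (hd : d ∈ Ioo (-(1 / 2) : ℝ) (1 / 2)) :
    ∃ M r : ℝ, 0 < r ∧ ∀ z : ℂ, 0 < z.im → ‖z - 1‖ < r → ‖Q d z‖ ≤ M * ‖z - 1‖ ^ (-2 * d) := by
  set p : ℝ := -2 * d - 2 with hp
  have hp1 : p < -1 := by linarith [hd.1]
  obtain ⟨r, hr, hrz⟩ : ∃ r : ℝ, 0 < r ∧ ∀ z : ℂ, ‖z - 1‖ < r →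
      ‖Complex.log z‖ ≤ 1 ∧ ‖z⁻¹‖ ≤ 2 ∧ ‖z - 1‖ ≤ 1 := by
    have h1 : ∀ᶠ z in 𝓝 (1 : ℂ), ‖Complex.log z‖ < 1 := by
      have : ContinuousAt (fun z => ‖Complex.log z‖) 1 :=
        (continuousAt_clog Complex.one_mem_slitPlane).norm
      exact this.eventually_lt_const (by simp)
    have h2 : ∀ᶠ z in 𝓝 (1 : ℂ), ‖z⁻¹‖ < 2 := by
      have : ContinuousAt (fun z : ℂ => ‖z⁻¹‖) 1 := (continuousAt_inv₀ one_ne_zero).norm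
      exact this.eventually_lt_const (by simp)
    have h3 : ∀ᶠ z in 𝓝 (1 : ℂ), ‖z - 1‖ < 1 := by
      have : ContinuousAt (fun z : ℂ => ‖z - 1‖) 1 := by fun_prop
      exact this.eventually_lt_const (by simp)
    obtain ⟨r, hr, h⟩ := Metric.eventually_nhds_iff.1 (h1.and (h2.and h3))
    refine ⟨r, hr, fun z hz => ?_⟩
    obtain ⟨a, b, c⟩ := h (y := z) (by rwa [dist_eq_norm])
    exact ⟨a.le, b.le, c.le⟩
  set B : ℝ := ∑' k : ℕ, (Real.pi + 2 * Real.pi * k) ^ p with hB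
  have hB0 : 0 ≤ B := tsum_nonneg fun k => by positivity
  have hc := densityConst_pos hd
  -- The factor `2` bounds `‖z⁻¹‖`, `2^{-p}` comes from `‖l‖ ≥ ‖z-1‖/2`, and `2B` bounds the two
  -- regular sums.
  refine ⟨densityConst d * 2 * (2 ^ (-p) + 2 * B), r, hr, fun z him hz => ?_⟩
  obtain ⟨hlog, hinv, hle⟩ := hrz z hz
  have hz0 := ne_zero_of_im_pos him
  have hz1 : 0 < ‖z - 1‖ := by
    rw [norm_pos_iff]
    intro h
    rw [sub_eq_zero] at h
    simp [h] at him
  set l : ℂ := -Complex.I * Complex.log z with hl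
  have hlre : l.re = z.arg := neg_I_mul_log_re z
  have hln : ‖l‖ = ‖Complex.log z‖ := by simp [hl]
  have hexp : Complex.exp (Complex.I * l) = z := exp_I_mul_neg_I_mul_log hz0
  have hlow : ‖z - 1‖ / 2 ≤ ‖l‖ := by
    have := Complex.norm_exp_sub_one_le hlog
    rw [Complex.exp_log hz0, ← hln] at this
    linarith
  have h1 : ‖l ^ (p : ℂ)‖ ≤ 2 ^ (-p) * ‖z - 1‖ ^ p := by
    rw [Complex.norm_cpow_real]
    have := Real.rpow_le_rpow_of_nonpos (by positivity) hlow (by linarith : p ≤ 0)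
    rwa [Real.div_rpow (norm_nonneg _) (by norm_num), div_eq_inv_mul,
      ← Real.rpow_neg (by norm_num)] at this
  have h2 : ‖latticeSum p (l + 2 * Real.pi)‖ ≤ B := by
    refine norm_latticeSum_le hp1 Real.pi_pos ?_
    have : (l + 2 * Real.pi).re = l.re + 2 * Real.pi := by simp
    rw [this, hlre]
    linarith [arg_pos_of_im_pos him, Real.pi_pos]
  have h3 : ‖latticeSum p (2 * Real.pi - l)‖ ≤ B := by
    refine norm_latticeSum_le hp1 Real.pi_pos ?_
    have : (2 * Real.pi - l).re = 2 * Real.pi - l.re := by simp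
    rw [this, hlre]
    linarith [Complex.arg_le_pi z]
  have h4 : ‖z⁻¹ - 2 + z‖ ≤ 2 * ‖z - 1‖ ^ 2 := by
    have : z⁻¹ - 2 + z = z⁻¹ * (z - 1) ^ 2 := by
      field_simp
      ring
    rw [this, norm_mul, norm_pow]
    gcongr
  have hpow : ‖z - 1‖ ^ 2 * ‖z - 1‖ ^ p = ‖z - 1‖ ^ (-2 * d) := by
    rw [← Real.rpow_natCast, ← Real.rpow_add hz1]
    congr 1
    rw [hp]
    push_cast
    ring
  have hpow2 : ‖z - 1‖ ^ 2 ≤ ‖z - 1‖ ^ (-2 * d) := by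
    rw [← Real.rpow_natCast]
    refine Real.rpow_le_rpow_of_exponent_ge hz1 hle ?_
    push_cast
    linarith [hd.1]
  rw [Q_eq_edgeQ_log hd him, edgeQ, ← hl, hexp, ← hp, norm_mul, norm_mul, norm_neg,
    Complex.norm_real, Real.norm_of_nonneg hc.le]
  calc densityConst d * ‖z⁻¹ - 2 + z‖ * ‖l ^ (p : ℂ) +
        (latticeSum p (l + 2 * Real.pi) + latticeSum p (2 * Real.pi - l))‖
      ≤ densityConst d * (2 * ‖z - 1‖ ^ 2) * (2 ^ (-p) * ‖z - 1‖ ^ p + (B + B)) := by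
        gcongr
        exact norm_add_le_of_le h1 (norm_add_le_of_le h2 h3)
    _ = densityConst d * 2 * (2 ^ (-p) * (‖z - 1‖ ^ 2 * ‖z - 1‖ ^ p) + 2 * B * ‖z - 1‖ ^ 2) := by
        ring
    _ ≤ densityConst d * 2 * (2 ^ (-p) * ‖z - 1‖ ^ (-2 * d) + 2 * B * ‖z - 1‖ ^ (-2 * d)) := by
        rw [hpow]
        gcongr
    _ = _ := by ring

theorem isBigO_Q_one {d : ℝ} (hd : d ∈ Ioo (-(1 / 2) : ℝ) (1 / 2)) :
    Q d =O[𝓝[cutPlane (Ici 0)] 1] fun z : ℂ => (z - 1) ^ ((-2 * d : ℝ) : ℂ) := by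
  obtain ⟨M, r, hr, h⟩ := exists_norm_Q_le_near_one_of_im_pos hd
  refine IsBigO.of_bound M ?_
  have hball : ∀ᶠ z in 𝓝[cutPlane (Ici 0)] (1 : ℂ), ‖z - 1‖ < min r 1 := by
    refine nhdsWithin_le_nhds ?_
    have : ContinuousAt (fun z : ℂ => ‖z - 1‖) 1 := by fun_prop
    exact this.eventually_lt_const (by simpa using hr)
  filter_upwards [hball, self_mem_nhdsWithin] with z hz hcut
  rw [Complex.norm_cpow_real]
  rcases lt_trichotomy z.im 0 with him | him | him
  · have hc := h (conj z) (by simpa using him)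
    have he : conj z - 1 = conj (z - 1) := by simp
    rw [he, RCLike.norm_conj, Q_conj, RCLike.norm_conj] at hc
    exact hc (lt_of_lt_of_le hz (min_le_left _ _))
  · exfalso
    have h1 : ‖z - 1‖ < 1 := lt_of_lt_of_le hz (min_le_right _ _)
    have h2 := (abs_lt.1 (lt_of_le_of_lt (Complex.abs_re_le_norm _) h1)).1
    simp only [Complex.sub_re, Complex.one_re] at h2
    exact hcut ⟨z.re, by rw [mem_Ici]; linarith, Complex.ext (by simp) (by simp [him])⟩
  · exact h z him (lt_of_lt_of_le hz (min_le_left _ _))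

theorem tendsto_Q_nhdsAbove_one {d : ℝ} (hd : d ∈ Ioo (-(1 / 2) : ℝ) (1 / 2)) (hneg : d < 0) :
    Tendsto (Q d) (nhdsAbove 1) (𝓝 0) := by
  have hle : nhdsAbove 1 ≤ 𝓝[cutPlane (Ici 0)] (1 : ℂ) := by
    rw [nhdsAbove, Complex.ofReal_one]
    exact nhdsWithin_mono _ fun z hz => mem_cutPlane_of_im_ne_zero (ne_of_gt hz)
  refine ((isBigO_Q_one hd).mono hle).trans_tendsto ?_
  rw [tendsto_zero_iff_norm_tendsto_zero]
  simp_rw [Complex.norm_cpow_real]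
  have h1 : Tendsto (fun z : ℂ => ‖z - 1‖) (nhdsAbove 1) (𝓝 0) := by
    have : ContinuousAt (fun z : ℂ => ‖z - 1‖) 1 := by fun_prop
    have h := this.tendsto.mono_left (nhdsWithin_le_nhds (s := {z : ℂ | 0 < z.im}))
    simpa [nhdsAbove] using h
  have h2 := h1.rpow_const (p := -2 * d) (Or.inr (by linarith))
  rwa [Real.zero_rpow (by linarith)] at h2

theorem exists_tendsto_Q_nhdsAbove {d : ℝ} (hd : d ∈ Ioo (-(1 / 2) : ℝ) (1 / 2)) {t : ℝ}
    (ht : 0 < t) (h : t ≠ 1 ∨ d < 0) : ∃ a, Tendsto (Q d) (nhdsAbove t) (𝓝 a) := by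
  by_cases h1 : t = 1
  · subst h1
    exact ⟨0, tendsto_Q_nhdsAbove_one hd (h.resolve_left (by simp))⟩
  · exact ⟨_, tendsto_Q_nhdsAbove hd ht h1⟩

theorem tendsto_and_symm_Qplus_Qminus {d : ℝ} (hd : d ∈ Ioo (-(1 / 2) : ℝ) (1 / 2)) {t : ℝ}
    (ht : 0 < t) (h : t ≠ 1 ∨ d < 0) :
    Tendsto (Q d) (nhdsAbove t) (𝓝 (Qplus d t)) ∧
      Tendsto (Q d) (nhdsBelow t) (𝓝 (Qminus d t)) ∧
      Qplus d t = Qminus d t⁻¹ ∧ Qminus d t = Qplus d t⁻¹ ∧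
      conj (Qplus d t) = Qminus d t ∧ conj (Qminus d t) = Qplus d t := by
  have key : ∀ s : ℝ, 0 < s → (s ≠ 1 ∨ d < 0) → Tendsto (Q d) (nhdsAbove s) (𝓝 (Qplus d s)) := by
    intro s hs h
    obtain ⟨a, ha⟩ := exists_tendsto_Q_nhdsAbove hd hs h
    rw [Qplus, ha.limUnder_eq]
    exact ha
  have hA := key t ht h
  have hB := tendsto_Q_nhdsBelow hA
  have hm : Qminus d t = conj (Qplus d t) := hB.limUnder_eq
  have hAi := key t⁻¹ (inv_pos.2 ht) (by simpa using h)
  have hi1 : Qplus d t = Qminus d t⁻¹ := (tendsto_Q_nhdsBelow_inv ht hA).limUnder_eq.symm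
  have hi2 : Qminus d t = Qplus d t⁻¹ := by
    have := tendsto_Q_nhdsBelow_inv (inv_pos.2 ht) hAi
    rw [inv_inv] at this
    exact this.limUnder_eq
  refine ⟨hA, ?_, hi1, hi2, hm.symm, ?_⟩
  · rw [hm]
    exact hB
  · rw [hm, Complex.conj_conj]

theorem sectionallyHolomorphic_Q {d : ℝ} (hd : d ∈ Ioo (-(1 / 2) : ℝ) (1 / 2)) (hd0 : d ≠ 0) :
    SectionallyHolomorphic (Q d) (Ici 0) {t : ℝ | t = 0 ∨ (t = 1 ∧ 0 < d)} := by
  refine ⟨differentiableOn_Q hd, fun t ht hS => ?_⟩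
  simp only [mem_ofPred_eq, not_or, not_and, not_lt] at hS
  have h := tendsto_and_symm_Qplus_Qminus hd (lt_of_le_of_ne ht (Ne.symm hS.1))
    (by
      by_cases h1 : t = 1
      · exact Or.inr (lt_of_le_of_ne (hS.2 h1) hd0)
      · exact Or.inl h1)
  exact ⟨⟨_, h.1⟩, ⟨_, h.2.1⟩⟩

/-- Both `angle z` and `2π - angle z` have imaginary part `±log ‖z‖`, so each lattice sum is `O((log
1/‖z‖)^{p+1})` with `p + 1 = -1 - 2d`. -/
theorem isBigO_Q_zero {d : ℝ} (hd : d ∈ Ioo (-(1 / 2) : ℝ) (1 / 2)) :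
    Q d =O[𝓝[cutPlane (Ici 0)] 0]
      fun z : ℂ => z⁻¹ * Complex.log z⁻¹ ^ ((-1 - 2 * d : ℝ) : ℂ) := by
  set p : ℝ := -2 * d - 2 with hp
  have hp1 : p < -1 := by linarith [hd.1]
  have hpe : -1 - 2 * d = p + 1 := by rw [hp]; ring
  obtain ⟨C, hC, hK⟩ := exists_norm_latticeSum_le hp1
  have hc := densityConst_pos hd
  refine IsBigO.of_bound (densityConst d * 4 * (2 * C * 2 ^ (-(p + 1)))) ?_
  -- This makes `L ≥ π`, hence `‖log z⁻¹‖ ≤ L + π ≤ 2L`, which converts the bound in `L` into one in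
  -- the complex logarithm.
  have hsmall : ∀ᶠ z in 𝓝[cutPlane (Ici 0)] (0 : ℂ), ‖z‖ < Real.exp (-Real.pi) := by
    refine nhdsWithin_le_nhds ?_
    have : ContinuousAt (fun z : ℂ => ‖z‖) 0 := by fun_prop
    exact this.eventually_lt_const (by simpa using Real.exp_pos _)
  filter_upwards [hsmall, self_mem_nhdsWithin] with z hz hcut
  have hz0 := zero_ne_of_mem_cutPlane hcut
  have hzn : 0 < ‖z‖ := norm_pos_iff.2 hz0
  set L : ℝ := -Real.log ‖z‖ with hL
  have hLpi : Real.pi ≤ L := by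
    have := (Real.log_lt_iff_lt_exp hzn).2 hz
    rw [hL]
    linarith
  have hL1 : 1 ≤ L := by linarith [Real.pi_gt_three]
  have hL0 : 0 < L := by linarith
  have hbound : ∀ l : ℂ, 0 < l.re → L ≤ ‖l‖ → ‖latticeSum p l‖ ≤ C * L ^ (p + 1) := by
    intro l hl hLl
    refine (hK l hl.le (hL1.trans hLl)).trans ?_
    exact mul_le_mul_of_nonneg_left (Real.rpow_le_rpow_of_nonpos hL0 hLl (by linarith)) hC.le
  have h1 : ‖latticeSum p (angle z)‖ ≤ C * L ^ (p + 1) := by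
    refine hbound _ (angle_re_pos z) ?_
    have := Complex.abs_im_le_norm (angle z)
    rw [angle_im, ← hL, abs_of_pos hL0] at this
    exact this
  have h2 : ‖latticeSum p (2 * Real.pi - angle z)‖ ≤ C * L ^ (p + 1) := by
    refine hbound _ (by simpa using angle_re_lt hcut) ?_
    have := Complex.abs_im_le_norm (2 * Real.pi - angle z)
    have him : (2 * Real.pi - angle z).im = -(angle z).im := by simp
    rw [him, angle_im, ← hL, abs_neg, abs_of_pos hL0] at this
    exact this
  have hz1 : ‖z‖ ≤ 1 := hz.le.trans (Real.exp_le_one_iff.2 (by linarith [Real.pi_pos]))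
  have h3 : ‖z⁻¹ - 2 + z‖ ≤ 4 * ‖z⁻¹‖ := by
    have hi : 1 ≤ ‖z⁻¹‖ := by
      rw [norm_inv]
      exact (one_le_inv₀ hzn).2 hz1
    refine (norm_add_le _ _).trans ?_
    have := norm_sub_le z⁻¹ 2
    rw [Complex.norm_ofNat] at this
    linarith
  have h4 : 2 ^ (p + 1) * L ^ (p + 1) ≤ ‖Complex.log z⁻¹‖ ^ (p + 1) := by
    rw [← Real.mul_rpow (by norm_num) hL0.le]
    have hre : (Complex.log z⁻¹).re = L := by
      rw [Complex.log_re, norm_inv, Real.log_inv]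
    refine Real.rpow_le_rpow_of_nonpos ?_ ?_ (by linarith)
    · refine lt_of_lt_of_le hL0 ?_
      rw [← hre]
      exact Complex.re_le_norm _
    · refine (Complex.norm_le_abs_re_add_abs_im _).trans ?_
      rw [hre, abs_of_pos hL0, Complex.log_im]
      linarith [Complex.abs_arg_le_pi z⁻¹]
  have h5 : L ^ (p + 1) ≤ 2 ^ (-(p + 1)) * ‖Complex.log z⁻¹‖ ^ (p + 1) := by
    rw [Real.rpow_neg (by norm_num), inv_mul_eq_div, le_div_iff₀ (by positivity)]
    linarith
  rw [Q_exp_I_mul hd (angle_re_pos z) (angle_re_lt hcut) (exp_I_mul_angle hcut), ← hp, norm_mul,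
    norm_mul, norm_neg, Complex.norm_real, Real.norm_of_nonneg hc.le, norm_mul,
    Complex.norm_cpow_real, hpe]
  calc densityConst d * ‖z⁻¹ - 2 + z‖ *
        ‖latticeSum p (angle z) + latticeSum p (2 * Real.pi - angle z)‖
      ≤ densityConst d * (4 * ‖z⁻¹‖) * (C * L ^ (p + 1) + C * L ^ (p + 1)) := by
        gcongr
        exact norm_add_le_of_le h1 h2
    _ = densityConst d * 4 * (2 * C) * ‖z⁻¹‖ * L ^ (p + 1) := by ring
    _ ≤ densityConst d * 4 * (2 * C) * ‖z⁻¹‖ *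
        (2 ^ (-(p + 1)) * ‖Complex.log z⁻¹‖ ^ (p + 1)) := by gcongr
    _ = _ := by ring

theorem isBigO_Q_cobounded {d : ℝ} (hd : d ∈ Ioo (-(1 / 2) : ℝ) (1 / 2)) :
    Q d =O[Bornology.cobounded ℂ ⊓ 𝓟 (cutPlane (Ici 0))]
      fun z : ℂ => z * Complex.log z ^ ((-1 - 2 * d : ℝ) : ℂ) := by
  have ht : Tendsto (fun z : ℂ => z⁻¹) (Bornology.cobounded ℂ ⊓ 𝓟 (cutPlane (Ici 0)))
      (𝓝[cutPlane (Ici 0)] 0) := by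
    refine tendsto_inf.2 ⟨tendsto_inv₀_cobounded.mono_left inf_le_left, ?_⟩
    exact (tendsto_principal_principal.2 fun z hz => inv_mem_cutPlane hz).mono_left inf_le_right
  have h := (isBigO_Q_zero hd).comp_tendsto ht
  refine h.congr (fun z => Q_inv d z) fun z => ?_
  simp only [Function.comp_apply, inv_inv]

end FGN

end

/-! ### The phase of `Q⁺` and the asymptotics of `η` -/

noncomputable section

namespace FGN

open Set

theorem sin_pi_mul_pos {d : ℝ} (hd : d ∈ Ioo (-(1 / 2) : ℝ) (1 / 2)) (h : 0 < d) :
    0 < Real.sin (Real.pi * d) :=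
  Real.sin_pos_of_pos_of_lt_pi (by positivity) (by nlinarith [hd.2, Real.pi_pos])

theorem sin_pi_mul_neg {d : ℝ} (hd : d ∈ Ioo (-(1 / 2) : ℝ) (1 / 2)) (h : d < 0) :
    Real.sin (Real.pi * d) < 0 := by
  have := sin_pi_mul_pos (d := -d) ⟨by linarith [hd.2], by linarith [hd.1]⟩ (by linarith)
  rw [mul_neg, Real.sin_neg] at this
  linarith

theorem latticeSum_add_conj {p : ℝ} {ζ : ℂ} (hζ : 0 < ζ.re) :
    latticeSum p ζ + latticeSum p (conj ζ) = ((2 * (latticeSum p ζ).re : ℝ) : ℂ) := by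
  rw [latticeSum_conj hζ, Complex.add_conj]

/-- `Q⁺(e^{-y})` divided by a positive factor. -/
def edgePhase (d y : ℝ) : ℂ :=
  Complex.exp (-(Real.pi * d : ℝ) * Complex.I) -
    ((2 * y ^ (2 * d + 2) * (latticeSum (-2 * d - 2) (Complex.I * y + 2 * Real.pi)).re : ℝ) : ℂ)

/-- Here `(iy)^p = -e^{-iπd} y^p`, while the sums at `2π ± iy` are conjugate and add up to a real
number. -/
theorem edgeQ_I_mul {d y : ℝ} (hy : 0 < y) :
    edgeQ d (Complex.I * y) =
      ((densityConst d * (Real.exp y * (Real.exp (-y) - 1) ^ 2) * y ^ (-2 * d - 2) : ℝ) : ℂ) *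
        edgePhase d y := by
  have hexp : Complex.exp (Complex.I * (Complex.I * y)) = (Real.exp (-y) : ℝ) := by
    rw [← mul_assoc, Complex.I_mul_I]
    push_cast
    ring_nf
  have hpow : (Complex.I * (y : ℂ)) ^ ((-2 * d - 2 : ℝ) : ℂ) =
      -Complex.exp (-(Real.pi * d : ℝ) * Complex.I) * ((y ^ (-2 * d - 2) : ℝ) : ℂ) := by
    rw [I_mul_cpow (by simpa using hy), I_cpow_ofReal, Complex.ofReal_cpow hy.le]
    congr 1
    rw [show ((Real.pi * (-2 * d - 2) / 2 : ℝ) : ℂ) * Complex.I =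
      -(Real.pi * d : ℝ) * Complex.I - Real.pi * Complex.I by push_cast; ring, Complex.exp_sub,
      Complex.exp_pi_mul_I]
    ring
  have hsum : latticeSum (-2 * d - 2) (Complex.I * y + 2 * Real.pi) +
      latticeSum (-2 * d - 2) (2 * Real.pi - Complex.I * y) =
      ((2 * (latticeSum (-2 * d - 2) (Complex.I * y + 2 * Real.pi)).re : ℝ) : ℂ) := by
    rw [← latticeSum_add_conj (by simp [Real.pi_pos])]
    congr 2
    simp [Complex.conj_ofNat]
    ring
  have hone : (y ^ (-2 * d - 2) : ℝ) * y ^ (2 * d + 2) = 1 := by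
    rw [← Real.rpow_add hy, show -2 * d - 2 + (2 * d + 2) = 0 by ring, Real.rpow_zero]
  have hX : ((Real.exp (-y) : ℝ) : ℂ)⁻¹ - 2 + (Real.exp (-y) : ℝ) =
      ((Real.exp y * (Real.exp (-y) - 1) ^ 2 : ℝ) : ℂ) := by
    have : (Real.exp (-y))⁻¹ - 2 + Real.exp (-y) = Real.exp y * (Real.exp (-y) - 1) ^ 2 := by
      rw [Real.exp_neg]
      have := Real.exp_ne_zero y
      field_simp
      ring
    rw [← this]
    push_cast
    ring
  have hone' : ((y ^ (-2 * d - 2) : ℝ) : ℂ) * ((y ^ (2 * d + 2) : ℝ) : ℂ) = 1 := by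
    exact_mod_cast hone
  rw [edgeQ, hexp, hpow, hsum, hX, edgePhase]
  push_cast at hone' ⊢
  linear_combination (densityConst d : ℂ) * (Complex.exp y * (Complex.exp (-y) - 1) ^ 2) *
    (2 * ((latticeSum (-2 * d - 2) (Complex.I * y + 2 * Real.pi)).re : ℂ)) * hone'

theorem Qplus_eq_edgePhase {d : ℝ} (hd : d ∈ Ioo (-(1 / 2) : ℝ) (1 / 2)) {t : ℝ} (ht : 0 < t)
    (h1 : t < 1) : ∃ r : ℝ, 0 < r ∧ Qplus d t = r * edgePhase d (-Real.log t) := by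
  have hy : 0 < -Real.log t := by linarith [Real.log_neg ht h1]
  have h := edgeQ_I_mul (d := d) hy
  have heq : Complex.I * ((-Real.log t : ℝ) : ℂ) = -Complex.I * (Real.log t : ℂ) := by
    push_cast
    ring
  rw [heq, ← Qplus_eq hd ht h1.ne] at h
  refine ⟨_, ?_, h⟩
  have hc := densityConst_pos hd
  rw [neg_neg, Real.exp_log ht]
  have : 0 < (t - 1) ^ 2 := by
    have : t - 1 ≠ 0 := by linarith
    positivity
  positivity

/-- Only the singular term contributes. That this is a nonzero constant for `d ≠ 0` keeps `Q⁺` off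
the real axis, hence away from the jump of `arg`. -/
theorem edgePhase_im (d y : ℝ) : (edgePhase d y).im = -Real.sin (Real.pi * d) := by
  rw [edgePhase, Complex.sub_im, Complex.ofReal_im, sub_zero, ← Complex.ofReal_neg,
    Complex.exp_ofReal_mul_I_im, Real.sin_neg]

theorem edgePhase_re (d y : ℝ) : (edgePhase d y).re = Real.cos (Real.pi * d) -
    2 * y ^ (2 * d + 2) * (latticeSum (-2 * d - 2) (Complex.I * y + 2 * Real.pi)).re := by
  rw [edgePhase, Complex.sub_re, Complex.ofReal_re, ← Complex.ofReal_neg,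
    Complex.exp_ofReal_mul_I_re, Real.cos_neg]

theorem sign_im_Qplus_of_lt_one {d : ℝ} (hd : d ∈ Ioo (-(1 / 2) : ℝ) (1 / 2)) (hd0 : d ≠ 0) {t : ℝ}
    (ht : t ∈ Ioo (0 : ℝ) 1) : SignType.sign (Qplus d t).im = -SignType.sign d := by
  obtain ⟨r, hr, h⟩ := Qplus_eq_edgePhase hd ht.1 ht.2
  have him : (Qplus d t).im = r * -Real.sin (Real.pi * d) := by
    rw [h, Complex.im_ofReal_mul, edgePhase_im]
  rw [him]
  rcases hd0.lt_or_gt with hlt | hgt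
  · have := sin_pi_mul_neg hd hlt
    rw [sign_pos (by nlinarith), sign_neg hlt, neg_neg]
  · have := sin_pi_mul_pos hd hgt
    rw [sign_neg (by nlinarith), sign_pos hgt]

theorem sign_im_Qplus_of_one_lt {d : ℝ} (hd : d ∈ Ioo (-(1 / 2) : ℝ) (1 / 2)) (hd0 : d ≠ 0) {t : ℝ}
    (ht : 1 < t) : SignType.sign (Qplus d t).im = SignType.sign d := by
  have ht0 : 0 < t := by linarith
  obtain ⟨-, -, -, h1, h2, -⟩ := tendsto_and_symm_Qplus_Qminus hd ht0 (Or.inl ht.ne')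
  have h3 := sign_im_Qplus_of_lt_one hd hd0 (t := t⁻¹) ⟨inv_pos.2 ht0, inv_lt_one_of_one_lt₀ ht⟩
  rw [← h1, ← h2, Complex.conj_im, Left.sign_neg, neg_inj] at h3
  exact h3

theorem im_Qplus_ne_zero {d : ℝ} (hd : d ∈ Ioo (-(1 / 2) : ℝ) (1 / 2)) (hd0 : d ≠ 0) {t : ℝ}
    (ht : 0 < t) (h1 : t ≠ 1) : (Qplus d t).im ≠ 0 := by
  have hs : SignType.sign d ≠ 0 := sign_ne_zero.2 hd0
  rw [← sign_ne_zero]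
  rcases h1.lt_or_gt with h | h
  · rw [sign_im_Qplus_of_lt_one hd hd0 ⟨ht, h⟩]
    rw [← Left.sign_neg]
    exact sign_ne_zero.2 (neg_ne_zero.2 hd0)
  · rwa [sign_im_Qplus_of_one_lt hd hd0 h]

theorem contDiffAt_arg {z : ℂ} (hz : z ∈ Complex.slitPlane) : ContDiffAt ℝ ∞ Complex.arg z := by
  have h : Complex.arg = fun z => Complex.imCLM (Complex.log z) := by
    funext w
    simp [Complex.log_im]
  rw [h]
  exact Complex.imCLM.contDiff.contDiffAt.comp z ((Complex.contDiffAt_log hz).restrict_scalars ℝ)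

theorem contDiffOn_eta {d : ℝ} (hd : d ∈ Ioo (-(1 / 2) : ℝ) (1 / 2)) (hd0 : d ≠ 0) :
    ContDiffOn ℝ ∞ (eta d) (Ioi 0 \ {1}) := by
  intro t ht
  have ht0 : 0 < t := ht.1
  have ht1 : t ≠ 1 := ht.2
  apply ContDiffAt.contDiffWithinAt
  have heq : eta d =ᶠ[𝓝 t] fun t => Complex.arg (edgeQ d (-Complex.I * (Real.log t : ℂ))) := by
    filter_upwards [eventually_gt_nhds ht0, eventually_ne_nhds ht1] with s hs hs1
    rw [eta, Qplus_eq hd hs hs1]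
  refine ContDiffAt.congr_of_eventuallyEq ?_ heq
  have hl : ContDiffAt ℝ ∞ (fun t : ℝ => -Complex.I * (Real.log t : ℂ)) t :=
    contDiffAt_const.mul (Complex.ofRealCLM.contDiff.contDiffAt.comp t
      (Real.contDiffAt_log.2 ht0.ne'))
  have hopen : IsOpen ({l : ℂ | -(2 * Real.pi) < l.re} ∩ {l : ℂ | l.re < 2 * Real.pi} ∩
      Complex.slitPlane) :=
    ((isOpen_lt continuous_const Complex.continuous_re).inter
      (isOpen_lt Complex.continuous_re continuous_const)).inter Complex.isOpen_slitPlane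
  have hy := Real.log_ne_zero_of_pos_of_ne_one ht0 ht1
  have hmem : -Complex.I * (Real.log t : ℂ) ∈ {l : ℂ | -(2 * Real.pi) < l.re} ∩
      {l : ℂ | l.re < 2 * Real.pi} ∩ Complex.slitPlane :=
    ⟨⟨by simp [Real.pi_pos], by simp [Real.pi_pos]⟩, neg_I_mul_mem_slitPlane hy⟩
  have hdiff : DifferentiableOn ℂ (edgeQ d) ({l : ℂ | -(2 * Real.pi) < l.re} ∩
      {l : ℂ | l.re < 2 * Real.pi} ∩ Complex.slitPlane) := fun l hl =>
    (differentiableAt_edgeQ hd hl.1.1 hl.1.2 hl.2).differentiableWithinAt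
  have he : ContDiffAt ℝ ∞ (edgeQ d) (-Complex.I * (Real.log t : ℂ)) :=
    ((hdiff.analyticAt (hopen.mem_nhds hmem)).contDiffAt).restrict_scalars ℝ
  have hs : edgeQ d (-Complex.I * (Real.log t : ℂ)) ∈ Complex.slitPlane := by
    rw [← Qplus_eq hd ht0 ht1]
    exact Complex.mem_slitPlane_iff.2 (Or.inr (im_Qplus_ne_zero hd hd0 ht0 ht1))
  have h1 : ContDiffAt ℝ ∞ (edgeQ d ∘ fun t : ℝ => -Complex.I * (Real.log t : ℂ)) t :=
    ContDiffAt.comp t he hl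
  exact ContDiffAt.comp (g := Complex.arg) t (contDiffAt_arg hs) h1

theorem eta_eq_neg_eta_inv {d : ℝ} (hd : d ∈ Ioo (-(1 / 2) : ℝ) (1 / 2)) (hd0 : d ≠ 0) {t : ℝ}
    (ht : 0 < t) (h1 : t ≠ 1) : eta d t = -eta d t⁻¹ := by
  obtain ⟨-, -, -, h2, h3, -⟩ := tendsto_and_symm_Qplus_Qminus hd ht (Or.inl h1)
  rw [eta, eta, ← h2, ← h3, Complex.arg_conj, if_neg, neg_neg]
  intro h
  exact im_Qplus_ne_zero hd hd0 ht h1 (Complex.arg_eq_pi_iff.1 h).2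

theorem eta_eq_arg_edgePhase {d : ℝ} (hd : d ∈ Ioo (-(1 / 2) : ℝ) (1 / 2)) {t : ℝ} (ht : 0 < t)
    (h1 : t < 1) : eta d t = Complex.arg (edgePhase d (-Real.log t)) := by
  obtain ⟨r, hr, h⟩ := Qplus_eq_edgePhase hd ht h1
  rw [eta, h, Complex.arg_real_mul _ hr]

theorem isBigO_neg_log_one_left :
    (fun t : ℝ => -Real.log t) =O[𝓝[<] 1] fun t : ℝ => 1 - t := by
  have h := (Real.hasDerivAt_log one_ne_zero).isBigO_sub
  simp only [Real.log_one, sub_zero] at h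
  have h2 := (h.neg_left.mono (nhdsWithin_le_nhds (s := Iio (1 : ℝ)))).neg_right
  simpa using h2

/-- As `y = -log t → 0` the lattice sum stays bounded, so the phase is `e^{-iπd} + O(y^{2d+2})`, and
`arg` is differentiable at `e^{-iπd}` because `|πd| < π/2`. -/
theorem isBigO_eta_one {d : ℝ} (hd : d ∈ Ioo (-(1 / 2) : ℝ) (1 / 2)) :
    (fun t : ℝ => eta d t - (-d * Real.pi)) =O[𝓝[<] 1] fun t : ℝ => (1 - t) ^ (2 + 2 * d) := by
  set e₀ : ℂ := Complex.exp (-(Real.pi * d : ℝ) * Complex.I) with he₀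
  have harg : Complex.arg e₀ = -d * Real.pi := by
    rw [he₀, ← Complex.ofReal_neg, Complex.exp_mul_I, Complex.arg_cos_add_sin_mul_I]
    · ring
    · constructor <;> nlinarith [hd.1, hd.2, Real.pi_pos]
  have hslit : e₀ ∈ Complex.slitPlane := by
    rw [Complex.mem_slitPlane_iff_arg, harg]
    refine ⟨?_, Complex.exp_ne_zero _⟩
    nlinarith [hd.1, hd.2, Real.pi_pos]
  have hy0 : ∀ᶠ t in 𝓝[<] (1 : ℝ), 0 < t := nhdsWithin_le_nhds (eventually_gt_nhds one_pos)
  have hpow : (fun t : ℝ => (-Real.log t) ^ (2 * d + 2)) =O[𝓝[<] 1]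
      fun t : ℝ => (1 - t) ^ (2 + 2 * d) := by
    rw [add_comm (2 * d)]
    refine isBigO_neg_log_one_left.rpow (by linarith [hd.1]) ?_
    filter_upwards [self_mem_nhdsWithin] with t ht
    have : t < 1 := ht
    simp only [Pi.zero_apply]
    linarith
  have hdiff : (fun t : ℝ => edgePhase d (-Real.log t) - e₀) =O[𝓝[<] 1]
      fun t : ℝ => (1 - t) ^ (2 + 2 * d) := by
    refine IsBigO.trans ?_ hpow
    refine IsBigO.of_bound (2 * ∑' k : ℕ, (2 * Real.pi + 2 * Real.pi * k) ^ (-2 * d - 2)) ?_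
    filter_upwards [hy0, self_mem_nhdsWithin] with t ht0 ht1
    have hy : 0 < -Real.log t := by linarith [Real.log_neg ht0 ht1]
    have hK := norm_latticeSum_le (p := -2 * d - 2) (by linarith [hd.1])
      (by positivity : 0 < 2 * Real.pi)
      (ζ := Complex.I * ((-Real.log t : ℝ) : ℂ) + 2 * Real.pi) (by simp)
    have hre := (Complex.abs_re_le_norm _).trans hK
    rw [edgePhase, sub_sub_cancel_left, norm_neg, Complex.norm_real, norm_mul, norm_mul,
      Real.norm_ofNat, Real.norm_eq_abs (Complex.re _)]
    calc _ ≤ 2 * ‖(-Real.log t) ^ (2 * d + 2)‖ *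
        ∑' k : ℕ, (2 * Real.pi + 2 * Real.pi * k) ^ (-2 * d - 2) := by gcongr
      _ = _ := by ring
  have htend : Tendsto (fun t : ℝ => edgePhase d (-Real.log t)) (𝓝[<] 1) (𝓝 e₀) := by
    rw [← tendsto_sub_nhds_zero_iff]
    refine hdiff.trans_tendsto ?_
    have h1 : Tendsto (fun t : ℝ => 1 - t) (𝓝[<] 1) (𝓝 0) := by
      have : ContinuousAt (fun t : ℝ => 1 - t) 1 := by fun_prop
      simpa using this.tendsto.mono_left (nhdsWithin_le_nhds (s := Iio (1 : ℝ)))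
    have h2 := h1.rpow_const (p := 2 + 2 * d) (Or.inr (by linarith [hd.1]))
    rwa [Real.zero_rpow (by linarith [hd.1])] at h2
  have hO := (((contDiffAt_arg hslit).differentiableAt (by simp)).isBigO_sub).comp_tendsto htend
  refine (hO.trans hdiff).congr' ?_ EventuallyEq.rfl
  filter_upwards [hy0, self_mem_nhdsWithin] with t ht0 ht1
  simp only [Function.comp_apply]
  rw [eta_eq_arg_edgePhase hd ht0 ht1, harg]

theorem re_latticePrimitive (p : ℝ) (ζ : ℂ) : (latticePrimitive p ζ).re =
    -(‖ζ‖ ^ (p + 1) * Real.cos (ζ.arg * (p + 1)) / (2 * Real.pi * (p + 1))) := by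
  rw [latticePrimitive, Complex.neg_re, ← Complex.cpow_ofReal_re]
  congr 1
  rw [← Complex.div_ofReal_re]
  push_cast
  rfl

theorem cos_pi_div_two_mul (d : ℝ) :
    Real.cos (Real.pi / 2 * (-2 * d - 2 + 1)) = -Real.sin (Real.pi * d) := by
  rw [show Real.pi / 2 * (-2 * d - 2 + 1) = -(Real.pi * d + Real.pi / 2) by ring, Real.cos_neg,
    Real.cos_add_pi_div_two]

/-- The factor `y^{2d+2} = y^{-p}` turns the leading term, of order `y^{p+1}`, into a multiple of
`y`, and the error `O(y^p)` into a constant. -/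
theorem exists_abs_re_edgePhase_sub_le {d : ℝ} (hd : d ∈ Ioo (-(1 / 2) : ℝ) (1 / 2)) :
    ∃ E : ℝ, 0 < E ∧ ∀ y : ℝ, 1 ≤ y →
      |(edgePhase d y).re - y * Real.sin (Real.pi * d) / (Real.pi * (1 + 2 * d))| ≤ E := by
  set p : ℝ := -2 * d - 2 with hp
  have hp1 : p < -1 := by linarith [hd.1]
  obtain ⟨C, hC, h⟩ := exists_norm_latticeSum_sub_le hp1
  -- The first `1` bounds `|cos πd|`; `C` is the error of the expansion at `iy`, and the `1` beside
  -- it pays for removing the term `k = 0`.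
  refine ⟨1 + 2 * (C + 1), by positivity, fun y hy => ?_⟩
  have hy0 : 0 < y := by linarith
  have hn : ‖Complex.I * (y : ℂ)‖ = y := by simp [abs_of_pos hy0]
  have harg : (Complex.I * (y : ℂ)).arg = Real.pi / 2 := by
    rw [mul_comm, Complex.arg_real_mul _ hy0, Complex.arg_I]
  have h1 := h (Complex.I * y) (by simp) (by rwa [hn])
  rw [latticeSum_eq_add hp1 (by simp), hn] at h1
  have h2 : ‖(Complex.I * (y : ℂ)) ^ (p : ℂ)‖ = y ^ p := by rw [Complex.norm_cpow_real, hn]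
  set K : ℂ := latticeSum p (Complex.I * y + 2 * Real.pi) with hK
  have h3 : ‖latticePrimitive p (Complex.I * y) - K‖ ≤ (C + 1) * y ^ p := by
    have : latticePrimitive p (Complex.I * y) - K = (latticePrimitive p (Complex.I * y) -
      ((Complex.I * (y : ℂ)) ^ (p : ℂ) + K)) + (Complex.I * (y : ℂ)) ^ (p : ℂ) := by ring
    rw [this, add_mul, one_mul]
    exact norm_add_le_of_le h1 h2.le
  have h4 := (Complex.abs_re_le_norm _).trans h3
  rw [Complex.sub_re, re_latticePrimitive, hn, harg, hp, cos_pi_div_two_mul, ← hp] at h4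
  have hone : y ^ (2 * d + 2) * y ^ p = 1 := by
    rw [← Real.rpow_add hy0, show 2 * d + 2 + p = 0 by rw [hp]; ring, Real.rpow_zero]
  have hone' : y ^ (2 * d + 2) * y ^ (p + 1) = y := by
    rw [← Real.rpow_add hy0, show 2 * d + 2 + (p + 1) = 1 by rw [hp]; ring, Real.rpow_one]
  have hq : (0 : ℝ) < 1 + 2 * d := by linarith [hd.1]
  have hpi := Real.pi_pos
  have hmain : y * Real.sin (Real.pi * d) / (Real.pi * (1 + 2 * d)) =
      2 * y ^ (2 * d + 2) * -(-(y ^ (p + 1) * -Real.sin (Real.pi * d) /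
        (2 * Real.pi * (p + 1)))) := by
    have hpd : p + 1 = -(1 + 2 * d) := by rw [hp]; ring
    rw [show 2 * y ^ (2 * d + 2) * -(-(y ^ (p + 1) * -Real.sin (Real.pi * d) /
      (2 * Real.pi * (p + 1)))) = 2 * (y ^ (2 * d + 2) * y ^ (p + 1)) * -Real.sin (Real.pi * d) /
      (2 * Real.pi * (p + 1)) by ring, hone', hpd]
    field_simp
  rw [edgePhase_re, ← hp, ← hK, hmain]
  set R : ℝ := -(y ^ (p + 1) * -Real.sin (Real.pi * d) / (2 * Real.pi * (p + 1))) with hR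
  have hpow : 0 < y ^ (2 * d + 2) := by positivity
  have h5 : |2 * y ^ (2 * d + 2) * (R - K.re)| ≤ 2 * (C + 1) := by
    rw [abs_mul, abs_of_pos (by positivity : 0 < 2 * y ^ (2 * d + 2))]
    calc 2 * y ^ (2 * d + 2) * |R - K.re| ≤ 2 * y ^ (2 * d + 2) * ((C + 1) * y ^ p) := by gcongr
      _ = 2 * (C + 1) * (y ^ (2 * d + 2) * y ^ p) := by ring
      _ = 2 * (C + 1) := by rw [hone, mul_one]
  rw [show Real.cos (Real.pi * d) - 2 * y ^ (2 * d + 2) * K.re - 2 * y ^ (2 * d + 2) * -R =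
    Real.cos (Real.pi * d) + 2 * y ^ (2 * d + 2) * (R - K.re) by ring]
  exact (abs_add_le _ _).trans (add_le_add (Real.abs_cos_le_one _) h5)

/-- Take imaginary parts in `log(1+u) = u + O(|u|²)` at `u = -i/x`; `|u| ≤ 1/2` makes the constant
`1`. -/
theorem abs_arg_ofReal_sub_I_add_inv_le {x : ℝ} (hx : 2 ≤ x) :
    |Complex.arg (x - Complex.I) + 1 / x| ≤ 1 / x ^ 2 := by
  have hx0 : 0 < x := by linarith
  have hxc : (x : ℂ) ≠ 0 := by exact_mod_cast hx0.ne'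
  set u : ℂ := -((1 / x : ℝ) : ℂ) * Complex.I with hu
  have hun : ‖u‖ = 1 / x := by
    rw [hu, norm_mul, norm_neg, Complex.norm_I, Complex.norm_real, Real.norm_of_nonneg (by positivity),
      mul_one]
  have hhalf : 1 / x ≤ 1 / 2 := one_div_le_one_div_of_le (by norm_num) hx
  have heq : (x : ℂ) - Complex.I = x * (1 + u) := by
    rw [hu]
    push_cast
    field_simp
    ring
  have h := Complex.norm_log_one_add_sub_self_le (z := u) (by rw [hun]; linarith)
  have h2 := (Complex.abs_im_le_norm _).trans h
  have him : (Complex.log (1 + u) - u).im = Complex.arg (1 + u) + 1 / x := by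
    rw [Complex.sub_im, Complex.log_im, hu, ← Complex.ofReal_neg, Complex.im_ofReal_mul,
      Complex.I_im]
    ring
  rw [heq, Complex.arg_real_mul _ hx0, ← him]
  refine h2.trans ?_
  rw [hun, show 1 / x ^ 2 = (1 / x) ^ 2 * 2 / 2 by field_simp]
  have h3 : (1 - 1 / x)⁻¹ ≤ 2 := by
    rw [inv_le_comm₀ (by linarith) (by norm_num)]
    linarith
  gcongr

/-- Write the phase as `σ(X - i)` with `σ = sin πd` and `X = y/b + O(1)`, `b = π(1+2d)`. Then `arg(X
- i) = -1/X + O(X⁻²) = -b/y + O(y⁻²)`, and a negative `σ` adds `π` because `X - i` lies below the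
real axis. -/
theorem isBigO_eta_zero {d : ℝ} (hd : d ∈ Ioo (-(1 / 2) : ℝ) (1 / 2)) (hd0 : d ≠ 0) :
    (fun t : ℝ => eta d t - ((if d < 0 then Real.pi else 0) +
      -(Real.pi * (1 + 2 * d)) / Real.log t⁻¹)) =O[𝓝[>] 0] fun t : ℝ => (Real.log t⁻¹ ^ 2)⁻¹ := by
  obtain ⟨E, hE, h⟩ := exists_abs_re_edgePhase_sub_le hd
  set σ : ℝ := Real.sin (Real.pi * d) with hσ
  have hσ0 : σ ≠ 0 := by
    rcases hd0.lt_or_gt with h | h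
    · exact (sin_pi_mul_neg hd h).ne
    · exact (sin_pi_mul_pos hd h).ne'
  set b : ℝ := Real.pi * (1 + 2 * d) with hb
  have hb0 : 0 < b := mul_pos Real.pi_pos (by linarith [hd.1])
  set E' : ℝ := E / |σ| with hE'
  have hE'0 : 0 < E' := div_pos hE (abs_pos.2 hσ0)
  -- The first summand comes from `1/X²`, the second from `b/y - 1/X`. Both use `X ≥ y/(2b)`, valid
  -- once `y ≥ 2E'b`; `y ≥ 4b` then gives `X ≥ 2`.
  refine IsBigO.of_bound (4 * b ^ 2 + 2 * E' * b ^ 2) ?_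
  have hlog : Tendsto (fun t : ℝ => Real.log t⁻¹) (𝓝[>] 0) atTop :=
    Real.tendsto_log_atTop.comp tendsto_inv_nhdsGT_zero
  have h01 : ∀ᶠ t in 𝓝[>] (0 : ℝ), t < 1 := nhdsWithin_le_nhds (eventually_lt_nhds one_pos)
  filter_upwards [h01, self_mem_nhdsWithin, hlog.eventually_ge_atTop 1,
    hlog.eventually_ge_atTop (4 * b), hlog.eventually_ge_atTop (2 * E' * b)] with t h1 h0 hy1 hy2 hy3
  rw [eta_eq_arg_edgePhase hd h0 h1, ← Real.log_inv]
  set y : ℝ := Real.log t⁻¹ with hy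
  have hy0 : 0 < y := by linarith
  set X : ℝ := (edgePhase d y).re / σ with hX
  have hXy : |X - y / b| ≤ E' := by
    have h2 := h y hy1
    have : X - y / b = ((edgePhase d y).re - y * σ / b) / σ := by
      rw [hX]
      field_simp
    rw [this, abs_div, hE']
    gcongr
  have hXlow : y / b / 2 ≤ X := by
    have h3 := (abs_le.1 hXy).1
    have : E' ≤ y / b / 2 := by
      rw [div_div, le_div_iff₀ (by positivity)]
      linarith
    linarith
  have hX2 : 2 ≤ X := by
    refine le_trans ?_ hXlow
    rw [div_div, le_div_iff₀ (by positivity)]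
    linarith
  have hX0 : 0 < X := by linarith
  have hW : edgePhase d y = (σ : ℂ) * (X - Complex.I) := by
    apply Complex.ext
    · rw [Complex.re_ofReal_mul]
      simp only [Complex.sub_re, Complex.ofReal_re, Complex.I_re, sub_zero, hX]
      field_simp
    · rw [Complex.im_ofReal_mul, edgePhase_im]
      simp [hσ]
  have harg : Complex.arg (edgePhase d y) =
      (if d < 0 then Real.pi else 0) + Complex.arg (X - Complex.I) := by
    rcases hd0.lt_or_gt with hneg | hpos
    · have hs := sin_pi_mul_neg hd hneg
      rw [hW, if_pos hneg, show (σ : ℂ) * (X - Complex.I) =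
        ((-σ : ℝ) : ℂ) * -(X - Complex.I) by push_cast; ring,
        Complex.arg_real_mul _ (by linarith), Complex.arg_neg_eq_arg_add_pi_of_im_neg (by simp),
        add_comm]
    · rw [hW, if_neg (by linarith), Complex.arg_real_mul _ (sin_pi_mul_pos hd hpos), zero_add]
  have h4 := abs_arg_ofReal_sub_I_add_inv_le hX2
  have h5 : 1 / X ≤ 2 * b / y := by
    rw [div_le_div_iff₀ hX0 hy0]
    rw [div_div, div_le_iff₀ (by positivity)] at hXlow
    linarith
  have h6 : 1 / X ^ 2 ≤ 4 * b ^ 2 * (y ^ 2)⁻¹ := by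
    calc 1 / X ^ 2 = (1 / X) ^ 2 := by ring
      _ ≤ (2 * b / y) ^ 2 := by gcongr
      _ = _ := by
        field_simp
        ring
  have h7 : |b / y - 1 / X| ≤ 2 * E' * b ^ 2 * (y ^ 2)⁻¹ := by
    have : b / y - 1 / X = (X - y / b) * (b / y) * (1 / X) := by
      field_simp
    rw [this, abs_mul, abs_mul, abs_of_pos (by positivity : 0 < b / y),
      abs_of_pos (by positivity : 0 < 1 / X)]
    calc |X - y / b| * (b / y) * (1 / X) ≤ E' * (b / y) * (2 * b / y) := by gcongr
      _ = _ := by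
        field_simp
  rw [harg, Real.norm_eq_abs, Real.norm_eq_abs, abs_of_pos (by positivity : 0 < (y ^ 2)⁻¹)]
  rw [show (if d < 0 then Real.pi else 0) + Complex.arg (X - Complex.I) -
    ((if d < 0 then Real.pi else 0) + -b / y) =
    (Complex.arg (X - Complex.I) + 1 / X) + (b / y - 1 / X) by ring, add_mul]
  exact (abs_add_le _ _).trans (add_le_add (h4.trans h6) h7)

end FGN

end

/-! ### The spectral density on the unit circle and the zero in `(-1, 0)` -/

noncomputable section

namespace FGN

open Set

theorem latticeSum_ofReal {p x : ℝ} (hx : 0 < x) :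
    latticeSum p x = ((∑' k : ℕ, (x + 2 * Real.pi * k) ^ p : ℝ) : ℂ) := by
  rw [latticeSum, Complex.ofReal_tsum]
  congr 1
  funext k
  rw [Complex.ofReal_cpow (by positivity)]
  push_cast
  rfl

theorem tsum_int_abs_rpow_eq {p x : ℝ} (hp : p < -1) (hx : 0 < x) (hx2 : x < 2 * Real.pi) :
    ((∑' k : ℤ, |x + 2 * Real.pi * (k : ℝ)| ^ p : ℝ) : ℂ) =
      latticeSum p x + latticeSum p (2 * Real.pi - x) := by
  have hx' : 0 < 2 * Real.pi - x := by linarith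
  have hcast : (2 * Real.pi - x : ℂ) = ((2 * Real.pi - x : ℝ) : ℂ) := by push_cast; rfl
  rw [hcast, latticeSum_ofReal hx, latticeSum_ofReal hx', ← Complex.ofReal_add]
  congr 1
  refine HasSum.tsum_eq (HasSum.of_nat_of_neg_add_one ?_ ?_)
  · refine (summable_add_two_pi_mul_nat_rpow hp hx).hasSum.congr_fun fun k => ?_
    rw [Int.cast_natCast, abs_of_pos (by positivity)]
  · refine (summable_add_two_pi_mul_nat_rpow hp hx').hasSum.congr_fun fun k => ?_
    rw [← abs_neg, abs_of_pos]
    · push_cast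
      ring_nf
    · push_cast
      have : 0 ≤ 2 * Real.pi * (k : ℝ) := by positivity
      linarith

theorem fGnDensity_neg (d x : ℝ) : fGnDensity d (-x) = fGnDensity d x := by
  rw [fGnDensity, fGnDensity]
  congr 1
  · congr 2
    rw [← RCLike.norm_conj (1 - Complex.exp (Complex.I * (x : ℂ))), map_sub, map_one,
      ← Complex.exp_conj, map_mul, Complex.conj_I, Complex.conj_ofReal]
    push_cast
    ring_nf
  · rw [← (Equiv.neg ℤ).tsum_eq]
    congr 1
    funext k
    rw [← abs_neg]
    simp only [Equiv.neg_apply]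
    push_cast
    ring_nf

theorem Q_exp_I_mul_ofReal_of_pos {d : ℝ} (hd : d ∈ Ioo (-(1 / 2) : ℝ) (1 / 2)) {x : ℝ}
    (hx : 0 < x) (hx2 : x < 2 * Real.pi) :
    Q d (Complex.exp (Complex.I * (x : ℂ))) = (fGnDensity d x : ℂ) := by
  set z : ℂ := Complex.exp (Complex.I * (x : ℂ)) with hz
  rw [Q_exp_I_mul hd (l := x) (by simpa using hx) (by simpa using hx2) hz.symm,
    ← tsum_int_abs_rpow_eq (by linarith [hd.1]) hx hx2, fGnDensity, ← hz]
  have hinv : z⁻¹ = conj z := by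
    rw [hz, ← Complex.exp_conj, ← Complex.exp_neg, map_mul, Complex.conj_I, Complex.conj_ofReal,
      neg_mul]
  have hz0 : z ≠ 0 := Complex.exp_ne_zero _
  have hnorm : ((‖1 - z‖ ^ 2 : ℝ) : ℂ) = -(z⁻¹ - 2 + z) := by
    rw [Complex.ofReal_pow, ← Complex.mul_conj', map_sub, map_one, ← hinv]
    field_simp
    ring
  rw [Complex.ofReal_mul, Complex.ofReal_mul, hnorm, densityConst]
  ring

theorem Q_exp_I_mul_ofReal {d : ℝ} (hd : d ∈ Ioo (-(1 / 2) : ℝ) (1 / 2)) {x : ℝ}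
    (hx : x ∈ Ioc (-Real.pi) Real.pi) (h0 : x ≠ 0) :
    Q d (Complex.exp (Complex.I * (x : ℂ))) = (fGnDensity d x : ℂ) := by
  rcases h0.lt_or_gt with h | h
  · have := Q_exp_I_mul_ofReal_of_pos hd (x := -x) (by linarith) (by linarith [hx.1, Real.pi_pos])
    rw [fGnDensity_neg, Complex.ofReal_neg, mul_neg, Complex.exp_neg, Q_inv] at this
    exact this
  · exact Q_exp_I_mul_ofReal_of_pos hd h (by linarith [hx.2, Real.pi_pos])

/-- The negative axis is the line `Re l = π`, on which `2π - l` is the conjugate of `l`; so `Q` is a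
multiple of the real part of one lattice sum. -/
theorem Q_neg_exp {d : ℝ} (hd : d ∈ Ioo (-(1 / 2) : ℝ) (1 / 2)) {y : ℝ}
    (h : (latticeSum (-2 * d - 2) (Real.pi + Complex.I * y)).re = 0) :
    Q d ((-Real.exp (-y) : ℝ) : ℂ) = 0 := by
  have hexp : Complex.exp (Complex.I * (Real.pi + Complex.I * y)) = ((-Real.exp (-y) : ℝ) : ℂ) := by
    rw [show Complex.I * (Real.pi + Complex.I * y) = Real.pi * Complex.I + Complex.I ^ 2 * y by ring,
      Complex.I_sq, Complex.exp_add, Complex.exp_pi_mul_I]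
    push_cast
    ring_nf
  have hpi := Real.pi_pos
  rw [Q_exp_I_mul hd (by simpa using hpi) (by simp; linarith) hexp]
  have hconj : 2 * Real.pi - (Real.pi + Complex.I * y) = conj ((Real.pi : ℂ) + Complex.I * y) := by
    simp
    ring
  rw [hconj, latticeSum_add_conj (by simpa using hpi), h]
  simp

/-- As `y → ∞` the argument of `π + iy` tends to `π/2`, so the leading term has the sign of
`-cos(π(p+1)/2)/(p+1) = sin(πd)/(p+1)`, which is negative. -/
theorem exists_re_latticeSum_neg {d : ℝ} (hd : d ∈ Ioo (-(1 / 2) : ℝ) (1 / 2)) (hpos : 0 < d) :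
    ∃ y : ℝ, 0 < y ∧ (latticeSum (-2 * d - 2) (Real.pi + Complex.I * y)).re < 0 := by
  set p : ℝ := -2 * d - 2 with hp
  have hp1 : p < -1 := by linarith [hd.1]
  obtain ⟨C, hC, h⟩ := exists_norm_latticeSum_sub_le hp1
  have hs := sin_pi_mul_pos hd hpos
  have hq : p + 1 < 0 := by linarith
  have hre : ∀ y : ℝ, ((Real.pi : ℂ) + Complex.I * y).re = Real.pi := by simp
  have harg : Tendsto (fun y : ℝ => ((Real.pi : ℂ) + Complex.I * y).arg) atTop
      (𝓝 (Real.pi / 2)) := by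
    have h1 : Tendsto (fun y : ℝ => ((Real.pi / y : ℝ) : ℂ) + Complex.I) atTop (𝓝 Complex.I) := by
      have h := (Complex.continuous_ofReal.tendsto 0).comp
        (tendsto_const_nhds.div_atTop tendsto_id : Tendsto (fun y : ℝ => Real.pi / y) atTop (𝓝 0))
      simpa using h.add_const Complex.I
    have hc : ContinuousAt Complex.arg Complex.I :=
      Complex.continuousAt_arg (Complex.mem_slitPlane_iff.2 (Or.inr (by simp)))
    have h2 := hc.tendsto.comp h1
    rw [Complex.arg_I] at h2
    refine h2.congr' ?_
    filter_upwards [eventually_gt_atTop 0] with y hy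
    have hyc : (y : ℂ) ≠ 0 := by exact_mod_cast hy.ne'
    simp only [Function.comp_apply]
    rw [← Complex.arg_real_mul _ hy]
    congr 1
    push_cast
    field_simp
  have hnorm : Tendsto (fun y : ℝ => ‖(Real.pi : ℂ) + Complex.I * y‖) atTop atTop := by
    refine tendsto_atTop_mono (fun y => ?_) tendsto_id
    have := Complex.abs_im_le_norm ((Real.pi : ℂ) + Complex.I * y)
    simp only [Complex.add_im, Complex.ofReal_im, Complex.mul_im, Complex.I_re, Complex.I_im,
      Complex.ofReal_re, zero_mul, one_mul, zero_add] at this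
    exact (le_abs_self y).trans (by simpa using this)
  -- This is the upper bound for the real part divided by `‖ζ‖^{p+1}`: the error `C‖ζ‖^p` becomes
  -- `C/‖ζ‖` and disappears in the limit.
  have hlim : Tendsto (fun y : ℝ =>
      -(Real.cos (((Real.pi : ℂ) + Complex.I * y).arg * (p + 1)) / (2 * Real.pi * (p + 1))) +
        C / ‖(Real.pi : ℂ) + Complex.I * y‖) atTop
      (𝓝 (-(Real.cos (Real.pi / 2 * (p + 1)) / (2 * Real.pi * (p + 1))) + 0)) :=
    ((((Real.continuous_cos.tendsto _).comp (harg.mul_const (p + 1))).div_const _).neg).add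
      (hnorm.const_div_atTop C)
  have hneg : -(Real.cos (Real.pi / 2 * (p + 1)) / (2 * Real.pi * (p + 1))) + 0 < 0 := by
    rw [hp, cos_pi_div_two_mul, ← hp, add_zero, neg_div, neg_neg]
    exact div_neg_of_pos_of_neg hs (mul_neg_of_pos_of_neg (by positivity) hq)
  obtain ⟨y, hlt, hy⟩ := ((hlim.eventually_lt_const hneg).and (eventually_gt_atTop 0)).exists
  refine ⟨y, hy, ?_⟩
  set ζ : ℂ := (Real.pi : ℂ) + Complex.I * y with hζ
  have hζpi : Real.pi ≤ ‖ζ‖ := by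
    rw [← hre y]
    exact Complex.re_le_norm _
  have hζ1 : 1 ≤ ‖ζ‖ := by linarith [Real.pi_gt_three]
  have hζ0 : 0 < ‖ζ‖ := by linarith
  have h1 := h ζ (by rw [hre]; exact Real.pi_pos.le) hζ1
  have h2 := (abs_le.1 ((Complex.abs_re_le_norm _).trans h1)).1
  rw [Complex.sub_re, re_latticePrimitive] at h2
  have hpow : ‖ζ‖ ^ p = ‖ζ‖ ^ (p + 1) / ‖ζ‖ := by
    rw [Real.rpow_add_one hζ0.ne', mul_div_cancel_right₀ _ hζ0.ne']
  rw [hpow] at h2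
  have h3 : 0 < ‖ζ‖ ^ (p + 1) := by positivity
  have h4 := mul_neg_of_pos_of_neg h3 hlt
  have h5 : ‖ζ‖ ^ (p + 1) * (-(Real.cos (ζ.arg * (p + 1)) / (2 * Real.pi * (p + 1))) + C / ‖ζ‖) =
      -(‖ζ‖ ^ (p + 1) * Real.cos (ζ.arg * (p + 1)) / (2 * Real.pi * (p + 1))) +
        C * (‖ζ‖ ^ (p + 1) / ‖ζ‖) := by ring
  rw [h5] at h4
  linarith

/-- At `y = 0` the lattice sum is a sum of positive reals, and for some `y > 0` its real part is
negative; the intermediate value theorem gives a zero at `-e^{-y}`. -/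
theorem exists_Q_eq_zero {d : ℝ} (hd : d ∈ Ioo (-(1 / 2) : ℝ) (1 / 2)) (hpos : 0 < d) :
    ∃ s ∈ Ioo (-1 : ℝ) 0, Q d (s : ℂ) = 0 := by
  obtain ⟨Y, hY, hneg⟩ := exists_re_latticeSum_neg hd hpos
  have hp1 : -2 * d - 2 < -1 := by linarith [hd.1]
  have hcont : ContinuousOn
      (fun y : ℝ => (latticeSum (-2 * d - 2) (Real.pi + Complex.I * y)).re) (Icc 0 Y) := by
    intro y _
    apply ContinuousAt.continuousWithinAt
    have h1 : ContinuousAt (latticeSum (-2 * d - 2)) (Real.pi + Complex.I * y) :=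
      (differentiableAt_latticeSum hp1 (by simpa using Real.pi_pos)).continuousAt
    have h2 : ContinuousAt (fun y : ℝ => (Real.pi : ℂ) + Complex.I * y) y := by fun_prop
    exact Complex.continuous_re.continuousAt.comp (ContinuousAt.comp (f := fun y : ℝ =>
      (Real.pi : ℂ) + Complex.I * y) h1 h2)
  have h0 : 0 < (latticeSum (-2 * d - 2) (Real.pi + Complex.I * (0 : ℝ))).re := by
    rw [Complex.ofReal_zero, mul_zero, add_zero, latticeSum_ofReal Real.pi_pos, Complex.ofReal_re]
    exact (summable_add_two_pi_mul_nat_rpow hp1 Real.pi_pos).tsum_pos (fun k => by positivity) 0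
      (by positivity)
  obtain ⟨y, hy, hy0⟩ := intermediate_value_Icc' hY.le hcont
    (show (0 : ℝ) ∈ Icc _ _ from ⟨hneg.le, h0.le⟩)
  have hy_pos : 0 < y := by
    refine lt_of_le_of_ne hy.1 ?_
    rintro rfl
    exact h0.ne' hy0
  refine ⟨-Real.exp (-y), ⟨?_, ?_⟩, Q_neg_exp hd hy0⟩
  · have := Real.exp_lt_one_iff.2 (neg_lt_zero.2 hy_pos)
    linarith
  · linarith [Real.exp_pos (-y)]

end FGN

end

theorem theorem3p1 (d : ℝ) (hd : d ∈ Set.Ioo (-(1 / 2) : ℝ) (1 / 2)) (hd0 : d ≠ 0) :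
    -- the polylogarithm in `Q` is the holomorphic extension of its power series to `ℂ \ [1, ∞)`
    (DifferentiableOn ℂ (FGN.polylog (-2 * d - 1)) (FGN.cutPlane (Set.Ici 1)) ∧
      ∀ z : ℂ, ‖z‖ < 1 →
        HasSum (fun k : ℕ => ((((k : ℝ) + 1) ^ (2 * d + 1) : ℝ) : ℂ) * z ^ (k + 1))
          (FGN.polylog (-2 * d - 1) z)) ∧
    -- `Q` is sectionally holomorphic off `[0, ∞)`, with a singularity at `1` only if `d > 0`
    FGN.SectionallyHolomorphic (FGN.Q d) (Set.Ici 0) {t : ℝ | t = 0 ∨ (t = 1 ∧ 0 < d)} ∧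
    -- symmetries of `Q`
    (∀ z ∈ FGN.cutPlane (Set.Ici 0),
      FGN.Q d z = FGN.Q d z⁻¹ ∧ conj (FGN.Q d z) = FGN.Q d (conj z)) ∧
    -- the limits exist, and their symmetries
    (∀ t : ℝ, 0 < t → (t ≠ 1 ∨ d < 0) →
      Tendsto (FGN.Q d) (FGN.nhdsAbove t) (𝓝 (FGN.Qplus d t)) ∧
      Tendsto (FGN.Q d) (FGN.nhdsBelow t) (𝓝 (FGN.Qminus d t)) ∧
      FGN.Qplus d t = FGN.Qminus d t⁻¹ ∧
      FGN.Qminus d t = FGN.Qplus d t⁻¹ ∧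
      conj (FGN.Qplus d t) = FGN.Qminus d t ∧
      conj (FGN.Qminus d t) = FGN.Qplus d t) ∧
    -- sign of the imaginary part
    (∀ t ∈ Set.Ioo (0 : ℝ) 1, SignType.sign (FGN.Qplus d t).im = -SignType.sign d) ∧
    (∀ t ∈ Set.Ioi (1 : ℝ), SignType.sign (FGN.Qplus d t).im = SignType.sign d) ∧
    -- restriction to the unit circle
    (∀ x ∈ Set.Ioc (-Real.pi) Real.pi, x ≠ 0 →
      FGN.Q d (Complex.exp (Complex.I * (x : ℂ))) = (FGN.fGnDensity d x : ℂ)) ∧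
    -- growth at `0`, `1` and `∞`
    (FGN.Q d =O[𝓝[FGN.cutPlane (Set.Ici 0)] 0]
      fun z : ℂ => z⁻¹ * Complex.log z⁻¹ ^ ((-1 - 2 * d : ℝ) : ℂ)) ∧
    (FGN.Q d =O[𝓝[FGN.cutPlane (Set.Ici 0)] 1]
      fun z : ℂ => (z - 1) ^ ((-2 * d : ℝ) : ℂ)) ∧
    (FGN.Q d =O[Bornology.cobounded ℂ ⊓ 𝓟 (FGN.cutPlane (Set.Ici 0))]
      fun z : ℂ => z * Complex.log z ^ ((-1 - 2 * d : ℝ) : ℂ)) ∧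
    -- a zero in `(-1, 0)`
    (0 < d → ∃ s ∈ Set.Ioo (-1 : ℝ) 0, FGN.Q d (s : ℂ) = 0) ∧
    -- the argument of `Q⁺`
    ContDiffOn ℝ ∞ (FGN.eta d) (Set.Ioi 0 \ {1}) ∧
    (∀ t : ℝ, 0 < t → t ≠ 1 → FGN.eta d t = -FGN.eta d t⁻¹) ∧
    ((fun t : ℝ => FGN.eta d t - (-d * Real.pi)) =O[𝓝[<] 1]
      fun t : ℝ => (1 - t) ^ (2 + 2 * d)) ∧
    (∃ c : ℝ,
      (fun t : ℝ => FGN.eta d t - ((if d < 0 then Real.pi else 0) + c / Real.log t⁻¹))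
        =O[𝓝[>] 0] fun t : ℝ => (Real.log t⁻¹ ^ 2)⁻¹) := by
  have hs : -2 < -2 * d - 1 := by linarith [hd.2]
  refine ⟨⟨FGN.differentiableOn_polylog hs (by linarith [hd.1]), fun z hz => ?_⟩,
    FGN.sectionallyHolomorphic_Q hd hd0,
    fun z _ => ⟨(FGN.Q_inv d z).symm, (FGN.Q_conj d z).symm⟩,
    fun t ht h => FGN.tendsto_and_symm_Qplus_Qminus hd ht h,
    fun t ht => FGN.sign_im_Qplus_of_lt_one hd hd0 ht,
    fun t ht => FGN.sign_im_Qplus_of_one_lt hd hd0 ht,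
    fun x hx h0 => FGN.Q_exp_I_mul_ofReal hd hx h0,
    FGN.isBigO_Q_zero hd, FGN.isBigO_Q_one hd, FGN.isBigO_Q_cobounded hd,
    FGN.exists_Q_eq_zero hd, FGN.contDiffOn_eta hd hd0,
    fun t ht h1 => FGN.eta_eq_neg_eta_inv hd hd0 ht h1, FGN.isBigO_eta_one hd,
    -(Real.pi * (1 + 2 * d)), FGN.isBigO_eta_zero hd hd0⟩
  have h := FGN.hasSum_polylog hs hz
  rwa [show -(-2 * d - 1) = 2 * d + 1 by ring] at h
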